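/- A rooted tree is a finite tree with a distinguished vertex, the root. A vertex other than the root is a leaf if exactly one edge is incident to it; the root is a leaf if and only if the tree has no other vertex. A rooted unlabelled tree is a rooted tree up to isomorphisms that preserve the root. Let $a_{n,k}$ be the number of rooted unlabelled trees with $n$ vertices and $k$ leaves. For $\zeta>0$ let $r(\zeta)$ be the radius of convergence of the power series $x\mapsto\sum_{n\ge 1}\bigl(\sum_k a_{n,k}\zeta^k\bigr)x^n$, and put $$x_0=\sup_{\zeta>0} r(\zeta)\sqrt{\zeta},\qquad C_1=\frac1{x_0}.$$ For an integer $d\ge 1$ let $N_d=\frac{(d-1)(d-2)}2+1$ if $d$ is odd and $N_d=\frac{(d-1)(d-2)}2+2$ if $d$ is even. **Theorem.** Let $L'_d$ be the number of rooted unlabelled trees with $n\le N_d$ vertices and at least $n-\left[\frac{d-1}2\right]\left(\left[\frac{d-1}2\right]-1\right)$ leaves. Then $L'_d$ is exponentially equivalent to $C_1^{d^2/2}$, that is, $$\log L'_d\sim\frac{d^2}2\log C_1\qquad(d\to\infty).$$ The same holds if the bound on the number of leaves is replaced by $n-1-\left[\frac{d-1}2\right]\left(\left[\frac{d-1}2\right]-1\right)$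 (the weak Arnold bound). -/

import Mathlib

/-- A rooted tree with vertex set `Fin n`: a tree with a distinguished vertex, the root. -/
structure RootedGraphTree (n : ℕ) where
  graph : SimpleGraph (Fin n)
  isTree : graph.IsTree
  root : Fin n

namespace RootedGraphTree

/-- A vertex other than the root is a leaf if exactly one edge is incident to it (equivalently, if
it has exactly one neighbour). The root is a leaf if and only if the tree has no other vertex. -/
def IsLeaf {n : ℕ} (t : RootedGraphTree n) (v : Fin n) : Prop :=
  (v ≠ t.root ∧ (t.graph.neighborSet v).ncard = 1) ∨ (v = t.root ∧ n = 1)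

/-- The number of leaves of a rooted tree. -/
noncomputable def numLeaves {n : ℕ} (t : RootedGraphTree n) : ℕ :=
  {v : Fin n | t.IsLeaf v}.ncard

/-- Two rooted trees are isomorphic if there is a graph isomorphism that sends root to root. -/
def Iso {n : ℕ} (s t : RootedGraphTree n) : Prop :=
  ∃ e : s.graph ≃g t.graph, e s.root = t.root

instance setoid (n : ℕ) : Setoid (RootedGraphTree n) where
  r := Iso
  iseqv :=
    { refl := fun t => ⟨SimpleGraph.Iso.refl, rfl⟩
      symm := by
        rintro s t ⟨e, he⟩
        refine ⟨e.symm, ?_⟩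
        rw [← he]
        exact e.symm_apply_apply _
      trans := by
        rintro s t u ⟨e, he⟩ ⟨f, hf⟩
        refine ⟨e.trans f, ?_⟩
        rw [← hf, ← he]
        rfl }

theorem numLeaves_eq_of_iso {n : ℕ} (s t : RootedGraphTree n) (h : Iso s t) :
    s.numLeaves = t.numLeaves := by
  obtain ⟨e, he⟩ := h
  have key : ∀ v, t.IsLeaf (e v) ↔ s.IsLeaf v := by
    intro v
    have h1 : e v = t.root ↔ v = s.root := by
      rw [← he]; exact e.injective.eq_iff
    have h2 : (t.graph.neighborSet (e v)).ncard = (s.graph.neighborSet v).ncard := by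
      have h3 : t.graph.neighborSet (e v) = e '' s.graph.neighborSet v := by
        ext w
        constructor
        · intro hw
          refine ⟨e.symm w, ?_, e.apply_symm_apply w⟩
          have hw' : t.graph.Adj (e v) w := hw
          rw [← e.apply_symm_apply w] at hw'
          exact e.map_adj_iff.mp hw'
        · rintro ⟨u, hu, rfl⟩
          exact e.map_adj_iff.mpr hu
      rw [h3, Set.ncard_image_of_injective _ e.injective]
    simp only [IsLeaf, ne_eq, h1, h2]
  have h4 : {v | t.IsLeaf v} = e '' {v | s.IsLeaf v} := by
    ext w
    constructor
    · intro hw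
      refine ⟨e.symm w, ?_, e.apply_symm_apply w⟩
      have hw' : t.IsLeaf w := hw
      rw [← e.apply_symm_apply w] at hw'
      exact (key _).mp hw'
    · rintro ⟨u, hu, rfl⟩
      exact (key u).mpr hu
  rw [numLeaves, numLeaves, h4, Set.ncard_image_of_injective _ e.injective]

end RootedGraphTree

/-- Rooted unlabelled trees with `n` vertices: rooted trees up to isomorphism. -/
def UnlabelledTree (n : ℕ) : Type := Quotient (RootedGraphTree.setoid n)

/-- The number of leaves of a rooted unlabelled tree. -/
noncomputable def UnlabelledTree.numLeaves {n : ℕ} (q : UnlabelledTree n) : ℕ :=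
  Quotient.lift RootedGraphTree.numLeaves RootedGraphTree.numLeaves_eq_of_iso q

instance RootedGraphTree.finite (n : ℕ) : Finite (RootedGraphTree n) :=
  Finite.of_injective (fun t : RootedGraphTree n => (t.graph, t.root)) (by
    rintro ⟨g, hg, r⟩ ⟨g', hg', r'⟩ h
    simp only [Prod.mk.injEq] at h
    obtain ⟨rfl, rfl⟩ := h
    rfl)

instance UnlabelledTree.finite (n : ℕ) : Finite (UnlabelledTree n) :=
  inferInstanceAs (Finite (Quotient (RootedGraphTree.setoid n)))

/-- `treeCount n k` is the number of rooted unlabelled trees with `n` vertices and `k` leaves. -/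
noncomputable def treeCount (n k : ℕ) : ℕ :=
  Nat.card {q : UnlabelledTree n // q.numLeaves = k}

/-- The leaf polynomial of the rooted unlabelled trees with `n` vertices, evaluated at `z`; a tree
with `n` vertices has at most `n` leaves. -/
noncomputable def leafPoly (n : ℕ) (z : ℝ) : ℝ :=
  ∑ k ∈ Finset.range (n + 1), (treeCount n k : ℝ) * z ^ k

/-- For `z > 0`, the radius of convergence in `x` of the generating series
`T(x, z) = ∑ n k, treeCount n k * x ^ n * z ^ k` (all coefficients are nonnegative). -/
noncomputable def treeRadius (z : ℝ) : ℝ :=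
  sSup {x : ℝ | 0 ≤ x ∧ Summable (fun n : ℕ => leafPoly n z * x ^ n)}

/-- The maximum of `z ↦ treeRadius z * √z` over `z > 0`. -/
noncomputable def maxRadius : ℝ :=
  sSup ((fun z : ℝ => treeRadius z * Real.sqrt z) '' Set.Ioi 0)

/-- The growth constant `C₁`. -/
noncomputable def growthC1 : ℝ := 1 / maxRadius

/-- `N_d`, for `d ≥ 1`. -/
def maxVertices (d : ℕ) : ℕ :=
  if Odd d then (d - 1) * (d - 2) / 2 + 1 else (d - 1) * (d - 2) / 2 + 2

/-- `[(d-1)/2] * ([(d-1)/2] - 1)`, for `d ≥ 1`. -/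
def arnoldBound (d : ℕ) : ℕ := ((d - 1) / 2) * ((d - 1) / 2 - 1)

/-- The number of rooted unlabelled trees with `n ≤ N` vertices and at least `n - b` leaves. -/
noncomputable def treesWithLeaves (N b : ℕ) : ℕ :=
  ∑ n ∈ Finset.Icc 1 N, Nat.card {q : UnlabelledTree n // (n : ℤ) - (b : ℤ) ≤ (q.numLeaves : ℤ)}

/-- Exponential equivalence of two sequences of positive numbers: `log (a d) ∼ log (b d)`. -/
def ExpEquiv (a b : ℕ → ℝ) : Prop :=
  Asymptotics.IsEquivalent Filter.atTop (fun d => Real.log (a d)) (fun d => Real.log (b d))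

/-!
Write `a n k` for the number of unlabelled rooted trees with `n` vertices and `k` leaves, and let `C
= 1 / maxRadius`. Up to `O(d)`, the trees counted have `n ≤ N` vertices and at least `n - N / 2`
leaves, where `N = d ^ 2 / 2`; the claim is that their number is `C ^ N` to exponential precision.

*Upper bound.* If `∑ n, leafPoly n z * x ^ n` converges and `z ≥ 1`, then `a n k * x ^ n * z ^ k` is
bounded, and for `k ≥ n - N / 2` and `n ≤ N` this bounds `a n k` by a constant times `(x * √z) ^
(-N)`, since `x * z ≤ 1` (`exists_treesWithLeaves_le`). So one has to know that the supremum
defining `maxRadius` is approached with weights `z ≥ 1`. This is a combinatorial fact: trees tend to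
have fewer leaves than inner vertices. Namely, there is a size-preserving injection `MTree.reflect`
of trees, with `leaves (reflect x) ≤ inner x` for each `x` with at least two vertices
(`MTree.leaves_reflect_le`). It gives `u ^ n * leafPoly n u⁻¹ ≤ leafPoly n u` for `u ≤ 1`, and so
`treeRadius u * √u ≤ treeRadius u⁻¹ * √u⁻¹`. The injection applies `MTree.rot`, an injective map of
forests of a given size, at every vertex from the bottom up. What this map has to achieve is seen
from a forest of `i` one-vertex trees and a forest `f` of larger trees. The tree obtained from it by
adding a new root has one inner vertex more than `f` has, whatever `i` is. The trees of `f` having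
been replaced, by induction, by trees with no more leaves than there were inner vertices, `rot` may
return a forest with at most one leaf more than `f`. For `i ≥ 2` the map therefore replaces all but
one of the one-vertex trees by a chain of new roots above the rest of the forest, and it moves the
forests that already have such a chain out of the way by shortening the chain by one root and adding
a one-vertex tree at its lower end.

*Lower bound.* Joining two trees to a new root shows that `halfCount N k = a (N - 1) k / 2` is
supermultiplicative (`halfCount_mul_le`). Hence the growth exponents of `a n k` form a concave
function of the proportion `k / n`, and convex duality gives, for each `c < log C`, a pair `(N, k)`
with `N ≤ 2 * k` and `halfCount N k ≥ exp (c * N)` (`exists_exp_le_halfCount`). Powers of this one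
pair fill the range of sizes required (`exp_le_treesWithLeaves`).

The combinatorics takes place in the type `MTree` of unordered trees, the initial algebra of the
multiset functor, which is identified with the isomorphism classes of rooted graphs that are trees
in `exists_equiv_unlabelledTree`.
-/

/-! ### Unordered rooted trees as an inductive type -/

/-- Multisets are a quotient of the polynomial functor of finite sequences. -/
noncomputable instance Multiset.instQPF : QPF Multiset.{0} where
  P := ⟨ℕ, Fin⟩
  abs p := (List.ofFn p.2 : Multiset _)
  repr s := ⟨s.toList.length, s.toList.get⟩
  abs_repr s := by
    change ((List.ofFn s.toList.get : List _) : Multiset _) = s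
    rw [List.ofFn_get, Multiset.coe_toList]
  abs_map f p := by
    obtain ⟨n, g⟩ := p
    change ((List.ofFn (f ∘ g) : List _) : Multiset _) = Multiset.map f (List.ofFn g : List _)
    rw [Multiset.map_coe, List.map_ofFn]

/-- The type of unordered rooted trees, the initial algebra of the multiset functor: a tree is the
multiset of the subtrees hanging from its root. -/
def MTree : Type := QPF.Fix Multiset.{0}

namespace MTree

/-- The tree whose root has the given multiset of subtrees below it. -/
noncomputable def node (m : Multiset MTree) : MTree := QPF.Fix.mk (F := Multiset.{0}) m

/-- The multiset of subtrees below the root. -/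
noncomputable def children (x : MTree) : Multiset MTree := QPF.Fix.dest (F := Multiset.{0}) x

@[simp] theorem children_node (m : Multiset MTree) : children (node m) = m := QPF.Fix.dest_mk m

@[simp] theorem node_children (x : MTree) : node (children x) = x := QPF.Fix.mk_dest x

theorem node_injective : Function.Injective node :=
  Function.LeftInverse.injective children_node

@[simp] theorem node_inj {m m' : Multiset MTree} : node m = node m' ↔ m = m' :=
  node_injective.eq_iff

theorem induction {p : MTree → Prop} (h : ∀ m : Multiset MTree, (∀ t ∈ m, p t) → p (node m))
    (x : MTree) : p x := by
  refine QPF.Fix.ind (F := Multiset.{0}) p (fun m hm => h m ?_) x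
  obtain ⟨u, rfl⟩ := hm
  intro t ht
  obtain ⟨⟨t', ht'⟩, -, rfl⟩ := Multiset.mem_map.1 ht
  exact ht'

/-- Structural recursion on unordered trees. -/
noncomputable def fold {α : Type} (g : Multiset α → α) : MTree → α := QPF.Fix.rec g

@[simp] theorem fold_node {α : Type} (g : Multiset α → α) (m : Multiset MTree) :
    fold g (node m) = g (m.map (fold g)) := QPF.Fix.rec_eq g m

/-- The number of vertices. -/
noncomputable def size : MTree → ℕ := fold fun m => m.sum + 1

/-- The number of leaves; the root counts only in the one-vertex tree. -/
noncomputable def leaves : MTree → ℕ := fold fun m => if m = 0 then 1 else m.sum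

/-- The number of vertices that are not leaves. -/
noncomputable def inner : MTree → ℕ := fold fun m => if m = 0 then 0 else m.sum + 1

/-- The number of vertices of a forest. -/
noncomputable def fsize (m : Multiset MTree) : ℕ := (m.map size).sum

/-- The number of leaves of a forest. -/
noncomputable def fleaves (m : Multiset MTree) : ℕ := (m.map leaves).sum

/-- The one-vertex tree. -/
noncomputable def leaf : MTree := node 0

theorem size_node (m : Multiset MTree) : size (node m) = fsize m + 1 := fold_node _ m

theorem leaves_node {m : Multiset MTree} (hm : m ≠ 0) : leaves (node m) = fleaves m := by
  rw [leaves, fold_node, if_neg (by simpa using hm)]; rfl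

theorem inner_node {m : Multiset MTree} (hm : m ≠ 0) :
    inner (node m) = (m.map inner).sum + 1 := by
  rw [inner, fold_node, if_neg (by simpa using hm)]

@[simp] theorem leaves_leaf : leaves leaf = 1 := by simp [leaves, leaf]

@[simp] theorem inner_leaf : inner leaf = 0 := by simp [inner, leaf]

@[simp] theorem size_leaf : size leaf = 1 := by simp [size_node, leaf, fsize]

@[simp] theorem fsize_zero : fsize 0 = 0 := rfl

@[simp] theorem fleaves_zero : fleaves 0 = 0 := rfl

@[simp] theorem fsize_cons (t : MTree) (m : Multiset MTree) :
    fsize (t ::ₘ m) = size t + fsize m := by simp [fsize]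

@[simp] theorem fleaves_cons (t : MTree) (m : Multiset MTree) :
    fleaves (t ::ₘ m) = leaves t + fleaves m := by simp [fleaves]

@[simp] theorem fsize_add (m m' : Multiset MTree) : fsize (m + m') = fsize m + fsize m' := by
  simp [fsize]

@[simp] theorem fleaves_add (m m' : Multiset MTree) :
    fleaves (m + m') = fleaves m + fleaves m' := by
  simp [fleaves]

@[simp] theorem fsize_singleton (t : MTree) : fsize {t} = size t := by simp [fsize]

@[simp] theorem fleaves_singleton (t : MTree) : fleaves {t} = leaves t := by simp [fleaves]

theorem one_le_size (x : MTree) : 1 ≤ size x := by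
  rw [← node_children x, size_node]; omega

theorem fsize_eq_zero {m : Multiset MTree} : fsize m = 0 ↔ m = 0 := by
  refine ⟨fun h => ?_, fun h => by simp [h]⟩
  induction m using Multiset.induction_on with
  | empty => rfl
  | cons t m _ => have := one_le_size t; simp at h; omega

theorem size_eq_one {x : MTree} : size x = 1 ↔ x = leaf := by
  refine ⟨fun h => ?_, fun h => by simp [h]⟩
  rw [← node_children x, size_node] at h
  rw [← node_children x, fsize_eq_zero.1 (by omega : fsize (children x) = 0)]; rfl

theorem leaves_add_inner (x : MTree) : leaves x + inner x = size x := by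
  induction x using MTree.induction with
  | h m ih =>
    by_cases hm : m = 0
    · subst hm; change leaves leaf + inner leaf = size leaf; simp
    · rw [leaves_node hm, inner_node hm, size_node, fleaves, fsize, ← add_assoc,
        ← Multiset.sum_map_add, Multiset.map_congr rfl ih]

theorem leaves_le_size (x : MTree) : leaves x ≤ size x := by
  have := leaves_add_inner x; omega

end MTree

/-! ### A rotation of forests that trades leaves for inner vertices -/

namespace MTree

noncomputable instance : DecidableEq MTree := Classical.decEq _

/-- The forest consisting of the single tree obtained by joining all roots to a new root. -/
noncomputable def raise (g : Multiset MTree) : Multiset MTree := {node g}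

theorem raise_injective : Function.Injective raise := fun g h e => by
  simpa [raise] using e

theorem raise_ne_zero (g : Multiset MTree) : raise g ≠ 0 := by simp [raise]

theorem fsize_raise (g : Multiset MTree) : fsize (raise g) = fsize g + 1 := by
  simp [raise, size_node]

theorem fleaves_raise {g : Multiset MTree} (hg : g ≠ 0) : fleaves (raise g) = fleaves g := by
  simp [raise, leaves_node hg]

/-- The forest `raise^[p.1] p.2`. -/
noncomputable def tower (p : ℕ × Multiset MTree) : Multiset MTree := raise^[p.1] p.2

theorem tower_succ (j : ℕ) (c : Multiset MTree) : tower (j + 1, c) = raise (tower (j, c)) :=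
  Function.iterate_succ_apply' ..

@[simp] theorem tower_zero (c : Multiset MTree) : tower (0, c) = c := rfl

/-- The pairs `(j, c)` in which `c` cannot be lowered any further: `c` is not a single tree with at
least two vertices, and the empty forest occurs only at height `0`. Each forest is the tower of
exactly one such pair. -/
def IsReduced (p : ℕ × Multiset MTree) : Prop :=
  (∀ h : Multiset MTree, h ≠ 0 → p.2 ≠ raise h) ∧ (p.2 = 0 → p.1 = 0)

theorem IsReduced.pred {j : ℕ} {c : Multiset MTree} (h : IsReduced (j + 1, c)) :
    IsReduced (j, c) :=
  ⟨h.1, fun hc => absurd (h.2 hc) (by simp)⟩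

theorem IsReduced.tower_ne_zero {j : ℕ} {c : Multiset MTree} (h : IsReduced (j + 1, c)) :
    tower (j, c) ≠ 0 := by
  cases j with
  | zero => exact fun hc => absurd (h.2 hc) (by simp)
  | succ j => rw [tower_succ]; exact raise_ne_zero _

theorem fsize_tower (j : ℕ) (c : Multiset MTree) : fsize (tower (j, c)) = fsize c + j := by
  induction j with
  | zero => rfl
  | succ j ih => rw [tower_succ, fsize_raise, ih, add_assoc]

theorem IsReduced.fleaves_tower {j : ℕ} {c : Multiset MTree} (h : IsReduced (j, c)) :
    fleaves (tower (j, c)) = fleaves c := by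
  induction j with
  | zero => rfl
  | succ j ih => rw [tower_succ, fleaves_raise h.tower_ne_zero, ih h.pred]

theorem tower_injOn {p q : ℕ × Multiset MTree} (hp : IsReduced p) (hq : IsReduced q)
    (h : tower p = tower q) : p = q := by
  obtain ⟨j, c⟩ := p
  obtain ⟨i, d⟩ := q
  induction j generalizing i with
  | zero =>
    cases i with
    | zero => simpa using h
    | succ i =>
      rw [tower_succ] at h
      exact absurd h (hp.1 _ hq.tower_ne_zero)
  | succ j ih =>
    cases i with
    | zero =>
      rw [tower_succ] at h
      exact absurd h.symm (hq.1 _ hp.tower_ne_zero)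
    | succ i =>
      rw [tower_succ, tower_succ] at h
      have := ih hp.pred i hq.pred (raise_injective h)
      simp_all

theorem exists_tower (g : Multiset MTree) : ∃ p, IsReduced p ∧ tower p = g := by
  induction hn : fsize g using Nat.strong_induction_on generalizing g with
  | _ n ih =>
    by_cases hg : ∃ h : Multiset MTree, h ≠ 0 ∧ g = raise h
    · obtain ⟨h, h0, rfl⟩ := hg
      obtain ⟨⟨j, c⟩, hp, rfl⟩ := ih (fsize h) (by rw [← hn, fsize_raise]; omega) h rfl
      refine ⟨(j + 1, c), ⟨hp.1, fun hc => ?_⟩, tower_succ j c⟩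
      simp only at hc
      have := hp.2 hc
      simp only at this
      subst this
      exact absurd hc h0
    · push Not at hg
      exact ⟨(0, g), ⟨hg, fun _ => rfl⟩, rfl⟩

/-- The rotation on reduced pairs. For a forest `f` of trees with at least two vertices and `i ≥ 2`
it runs through the cycle `(0, f + i leaves)`, `(i - 1, f + 1 leaf)`, `(i - 2, f + 2 leaves)`, …,
`(1, f + (i - 1) leaves)`; it fixes the pairs whose forest has no one-vertex tree. -/
noncomputable def rotPair (p : ℕ × Multiset MTree) : ℕ × Multiset MTree :=
  if p.2.count leaf = 0 then p
  else if p.1 = 0 then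
    (p.2.count leaf - 1, leaf ::ₘ p.2.filter (· ≠ leaf))
  else (p.1 - 1, leaf ::ₘ p.2)

theorem filter_add_replicate (c : Multiset MTree) :
    c.filter (· ≠ leaf) + Multiset.replicate (c.count leaf) leaf = c := by
  rw [← Multiset.filter_eq', add_comm]
  exact Multiset.filter_add_not _ _

theorem fleaves_eq (c : Multiset MTree) :
    fleaves c = fleaves (c.filter (· ≠ leaf)) + c.count leaf := by
  conv_lhs => rw [← filter_add_replicate c, fleaves_add]
  simp [fleaves]

theorem fsize_eq (c : Multiset MTree) :
    fsize c = fsize (c.filter (· ≠ leaf)) + c.count leaf := by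
  conv_lhs => rw [← filter_add_replicate c, fsize_add]
  simp [fsize]

theorem isReduced_of_leaf_mem {j : ℕ} {c : Multiset MTree} (h : leaf ∈ c) : IsReduced (j, c) := by
  refine ⟨fun g hg hc => ?_, fun hc => ?_⟩
  · rw [show c = raise g from hc, raise, Multiset.mem_singleton, leaf, node_inj] at h
    exact hg h.symm
  · rw [show c = 0 from hc] at h
    simp at h

theorem IsReduced.rotPair {p : ℕ × Multiset MTree} (hp : IsReduced p) : IsReduced (rotPair p) := by
  unfold MTree.rotPair
  split_ifs
  · exact hp
  · exact isReduced_of_leaf_mem (Multiset.mem_cons_self _ _)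
  · exact isReduced_of_leaf_mem (Multiset.mem_cons_self _ _)

theorem rotPair_injective : Function.Injective rotPair := by
  rintro ⟨j, c⟩ ⟨i, d⟩ h
  have hcd : c.count leaf = d.count leaf → c.filter (· ≠ leaf) = d.filter (· ≠ leaf) → c = d :=
    fun h1 h2 => by rw [← filter_add_replicate c, h1, h2, filter_add_replicate]
  have key : ∀ e : Multiset MTree, (leaf ::ₘ e.filter (· ≠ leaf)).count leaf = 1 := by simp
  have key' : ∀ e : Multiset MTree, (leaf ::ₘ e).count leaf = e.count leaf + 1 := by simp
  unfold rotPair at h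
  simp only at h
  split_ifs at h with h1 h2 h3 h4 h5 h6 h7 h8
  all_goals
    rw [Prod.mk.injEq] at h
    have hc := congrArg (Multiset.count leaf) h.2
    try simp only [key, key'] at hc
  all_goals try omega
  · exact Prod.ext h.1 h.2
  · have h9 := (Multiset.cons_inj_right _).1 h.2
    exact Prod.ext (by simp only; omega) (hcd (by omega) h9)
  · have h9 := (Multiset.cons_inj_right _).1 h.2
    exact Prod.ext (by simp only; omega) h9

theorem fsize_tower_rotPair (p : ℕ × Multiset MTree) :
    fsize (tower (rotPair p)) = fsize (tower p) := by
  obtain ⟨j, c⟩ := p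
  have := fsize_eq c
  unfold rotPair
  simp only
  split_ifs <;> simp only [fsize_tower, fsize_cons, size_leaf] <;> omega

/-- Along a cycle of the rotation the bound is an equality: both sides grow by one with each
one-vertex tree that is taken from the tower of roots. -/
theorem fleaves_tower_rotPair_le {p : ℕ × Multiset MTree} (hp : IsReduced p) :
    fleaves (tower (rotPair p)) ≤ fleaves ((tower p).filter (· ≠ leaf)) + 1 := by
  have hr := hp.rotPair
  obtain ⟨j, c⟩ := p
  have hfilter : j ≠ 0 → fleaves ((tower (j, c)).filter (· ≠ leaf)) = fleaves c := by
    intro hj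
    obtain ⟨i, rfl⟩ := Nat.exists_eq_succ_of_ne_zero hj
    rw [← hp.fleaves_tower, tower_succ, raise, Multiset.filter_eq_self.2]
    intro t ht
    rw [Multiset.mem_singleton.1 ht]
    intro h
    exact hp.tower_ne_zero (node_injective h)
  have := fleaves_eq c
  rcases h : rotPair (j, c) with ⟨i, d⟩
  rw [h] at hr
  rw [hr.fleaves_tower]
  have hd := h
  unfold rotPair at hd
  simp only at hd
  split_ifs at hd with h1 h2
  all_goals obtain ⟨rfl, rfl⟩ := Prod.mk.inj hd
  · by_cases hj : j = 0
    · subst hj; rw [tower_zero]; omega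
    · rw [hfilter hj]; omega
  · subst h2
    rw [tower_zero, fleaves_cons, leaves_leaf]; omega
  · rw [hfilter h2, fleaves_cons, leaves_leaf]; omega

/-- The rotation on forests. -/
noncomputable def rot (g : Multiset MTree) : Multiset MTree :=
  tower (rotPair (exists_tower g).choose)

theorem rot_injective : Function.Injective rot := by
  intro g h e
  obtain ⟨hg, hg'⟩ := (exists_tower g).choose_spec
  obtain ⟨hh, hh'⟩ := (exists_tower h).choose_spec
  have := rotPair_injective (tower_injOn hg.rotPair hh.rotPair e)
  rw [← hg', ← hh', this]

theorem fsize_rot (g : Multiset MTree) : fsize (rot g) = fsize g := by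
  rw [rot, fsize_tower_rotPair, (exists_tower g).choose_spec.2]

theorem fleaves_rot_le (g : Multiset MTree) :
    fleaves (rot g) ≤ fleaves (g.filter (· ≠ leaf)) + 1 := by
  have h := (exists_tower g).choose_spec
  exact (fleaves_tower_rotPair_le h.1).trans_eq (by rw [h.2])

/-- The injection of trees obtained by applying the rotation at every vertex, from the bottom up. -/
noncomputable def reflect : MTree → MTree := fold fun m => node (rot m)

theorem reflect_node (m : Multiset MTree) : reflect (node m) = node (rot (m.map reflect)) :=
  fold_node _ m

theorem size_reflect (x : MTree) : size (reflect x) = size x := by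
  induction x using MTree.induction with
  | h m ih =>
    rw [reflect_node, size_node, size_node, fsize_rot, fsize, fsize, Multiset.map_map]
    congr 2
    exact Multiset.map_congr rfl ih

theorem reflect_eq_leaf {x : MTree} : reflect x = leaf ↔ x = leaf := by
  rw [← size_eq_one, size_reflect, size_eq_one]

theorem reflect_injective : Function.Injective reflect := by
  intro x
  induction x using MTree.induction with
  | h m ih =>
    intro y h
    rw [← node_children y] at h ⊢
    rw [reflect_node, reflect_node, node_inj] at h
    have h1 := rot_injective h
    rw [← Multiset.rel_eq, Multiset.rel_map] at h1
    rw [node_inj, ← Multiset.rel_eq]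
    exact h1.mono fun a ha b _ hab => ih a ha hab

/-- The injection turns inner vertices into an upper bound for leaves. -/
theorem leaves_reflect_le {x : MTree} (hx : x ≠ leaf) : leaves (reflect x) ≤ inner x := by
  induction x using MTree.induction with
  | h m ih =>
    have hm : m ≠ 0 := fun h => hx (by rw [h]; rfl)
    have hm' : rot (m.map reflect) ≠ 0 := fun h => by
      rw [← fsize_eq_zero, fsize_rot, fsize_eq_zero] at h
      simp [hm] at h
    rw [reflect_node, leaves_node hm', inner_node hm]
    refine (fleaves_rot_le _).trans (Nat.add_le_add_right ?_ 1)
    have hf : (m.map reflect).filter (· ≠ leaf) = (m.filter (· ≠ leaf)).map reflect := by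
      rw [Multiset.filter_map]
      congr 1
      exact Multiset.filter_congr fun t _ => not_congr reflect_eq_leaf
    rw [hf, fleaves, Multiset.map_map]
    have h1 : ((m.filter (· ≠ leaf)).map (leaves ∘ reflect)).sum
        ≤ ((m.filter (· ≠ leaf)).map inner).sum := by
      refine Multiset.sum_map_le_sum_map _ _ fun t ht => ?_
      rw [Multiset.mem_filter] at ht
      exact ih t ht.1 ht.2
    refine h1.trans ?_
    conv_rhs => rw [← Multiset.filter_add_not (· ≠ leaf) m, Multiset.map_add, Multiset.sum_add]
    exact Nat.le_add_right _ _

end MTree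

/-! ### Rooted graphs and unordered trees -/

open MTree

/-- A rooted tree on the vertex type `V`, given by the parent of each vertex other than the root
(the value of `parent` at the root is irrelevant) and by the distances to the root. -/
structure ParentTree (V : Type) where
  root : V
  parent : V → V
  depth : V → ℕ
  depth_root : depth root = 0
  depth_parent : ∀ v, v ≠ root → depth (parent v) + 1 = depth v

namespace ParentTree

variable {V W : Type}

/-- The graph joining each vertex other than the root to its parent. -/
def toGraph (T : ParentTree V) : SimpleGraph V where
  Adj u v := (u ≠ T.root ∧ T.parent u = v) ∨ (v ≠ T.root ∧ T.parent v = u)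
  symm := ⟨fun _ _ h => h.symm⟩
  loopless := ⟨fun v h => by
    rcases h with h | h <;>
    · have := T.depth_parent v h.1
      rw [h.2] at this
      omega⟩

theorem toGraph_connected (T : ParentTree V) : T.toGraph.Connected := by
  have key : ∀ k v, T.depth v = k → T.toGraph.Reachable v T.root := by
    intro k
    induction k with
    | zero =>
      intro v hv
      by_cases h : v = T.root
      · rw [h]
      · have := T.depth_parent v h
        omega
    | succ k ih =>
      intro v hv
      by_cases h : v = T.root
      · rw [h]
      · have hadj : T.toGraph.Adj v (T.parent v) := Or.inl ⟨h, rfl⟩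
        exact hadj.reachable.trans (ih _ (by have := T.depth_parent v h; omega))
  have : Nonempty V := ⟨T.root⟩
  exact ⟨fun u v => (key _ u rfl).trans (key _ v rfl).symm⟩

variable [Fintype V] [Fintype W]

open Classical in
/-- The vertices whose parent is `v`. -/
noncomputable def children (T : ParentTree V) (v : V) : Finset V :=
  {w | w ≠ T.root ∧ T.parent w = v}

theorem mem_children {T : ParentTree V} {v w : V} :
    w ∈ T.children v ↔ w ≠ T.root ∧ T.parent w = v := by simp [children]

theorem depth_of_mem_children {T : ParentTree V} {v w : V} (h : w ∈ T.children v) :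
    T.depth w = T.depth v + 1 := by
  obtain ⟨h1, rfl⟩ := mem_children.1 h
  exact (T.depth_parent w h1).symm

/-- `c v` is the unordered tree of the descendants of `v`, for each vertex `v`. -/
def IsCode (T : ParentTree V) (c : V → MTree) : Prop :=
  ∀ v, c v = node ((T.children v).val.map c)

theorem exists_depth_le (T : ParentTree V) : ∃ D, ∀ v, T.depth v ≤ D :=
  ⟨∑ v, T.depth v, fun v => Finset.single_le_sum (fun _ _ => Nat.zero_le _) (Finset.mem_univ v)⟩

theorem exists_isCode (T : ParentTree V) : ∃ c, T.IsCode c := by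
  obtain ⟨D, hD⟩ := T.exists_depth_le
  let C : ℕ → V → MTree := fun k =>
    k.rec (fun _ => leaf) fun _ f v => node ((T.children v).val.map f)
  refine ⟨fun v => C (D + 1 - T.depth v) v, fun v => ?_⟩
  have h : D + 1 - T.depth v = D - T.depth v + 1 := by have := hD v; omega
  change C (D + 1 - T.depth v) v = _
  rw [h]
  change node ((T.children v).val.map (C (D - T.depth v))) = _
  congr 1
  refine Multiset.map_congr rfl fun w hw => ?_
  have := depth_of_mem_children hw
  rw [show D + 1 - T.depth w = D - T.depth v by omega]

theorem IsCode.unique {T : ParentTree V} {c d : V → MTree} (hc : T.IsCode c) (hd : T.IsCode d) :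
    c = d := by
  obtain ⟨D, hD⟩ := T.exists_depth_le
  have key : ∀ k v, D - T.depth v < k → c v = d v := by
    intro k
    induction k with
    | zero => intro v h; omega
    | succ k ih =>
      intro v _
      rw [hc v, hd v]
      congr 1
      refine Multiset.map_congr rfl fun w hw => ih w ?_
      have := depth_of_mem_children hw
      have := hD w
      omega
  exact funext fun v => key _ v (Nat.lt_succ_self _)

theorem IsCode.eq_leaf_iff {T : ParentTree V} {c : V → MTree} (hc : T.IsCode c) (v : V) :
    c v = leaf ↔ T.children v = ∅ := by
  rw [hc v, leaf, node_inj, Multiset.map_eq_zero, Finset.val_eq_zero]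

/-- Equal multisets of labels are matched by a bijection respecting the labels. -/
theorem exists_matching {α β γ : Type} [DecidableEq γ] {s : Finset α} {t : Finset β} {c : α → γ}
    {d : β → γ} (h : s.val.map c = t.val.map d) (b₀ : β) :
    ∃ f : α → β, (∀ a ∈ s, f a ∈ t ∧ d (f a) = c a) ∧ Set.InjOn f s := by
  classical
  induction s using Finset.induction_on generalizing t with
  | empty => exact ⟨fun _ => b₀, by simp, by simp⟩
  | insert a s ha ih =>
    rw [Finset.insert_val_of_notMem ha, Multiset.map_cons] at h
    have hm : c a ∈ t.val.map d := h ▸ Multiset.mem_cons_self _ _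
    obtain ⟨b, hb, hba⟩ := Multiset.mem_map.1 hm
    have hbt : b ∈ t := hb
    rw [← Finset.insert_erase hbt, Finset.insert_val_of_notMem (Finset.notMem_erase b t),
      Multiset.map_cons, hba, Multiset.cons_inj_right] at h
    obtain ⟨f, hf, hinj⟩ := ih h
    have hne : ∀ x ∈ s, x ≠ a := fun x hx hxa => ha (hxa ▸ hx)
    refine ⟨Function.update f a b, ?_, ?_⟩
    · intro x hx
      rcases Finset.mem_insert.1 hx with rfl | hx
      · simpa using ⟨hbt, hba⟩
      · rw [Function.update_of_ne (hne x hx)]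
        exact ⟨Finset.mem_of_mem_erase (hf x hx).1, (hf x hx).2⟩
    · rw [Finset.coe_insert, Set.injOn_insert (by exact_mod_cast ha)]
      refine ⟨fun x hx y hy hxy => ?_, ?_⟩
      · rw [Function.update_of_ne (hne x hx), Function.update_of_ne (hne y hy)] at hxy
        exact hinj hx hy hxy
      · rintro ⟨x, hx, hxb⟩
        rw [Function.update_of_ne (hne x hx), Function.update_self] at hxb
        exact Finset.notMem_erase b t (hxb ▸ (hf x hx).1)

/-- If the roots carry the same unordered tree, a map is built from the root upwards, matching the
children of each vertex with the children of its image that carry the same unordered tree. -/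
theorem exists_injective_of_isCode {T : ParentTree V} {S : ParentTree W} {c : V → MTree}
    {d : W → MTree} (hc : T.IsCode c) (hd : S.IsCode d) (h : c T.root = d S.root) :
    ∃ e : V → W, Function.Injective e ∧ e T.root = S.root ∧
      ∀ v, v ≠ T.root → e v ≠ S.root ∧ S.parent (e v) = e (T.parent v) := by
  have hσ : ∀ u w, ∃ f : V → W, c u = d w →
      (∀ a ∈ T.children u, f a ∈ S.children w ∧ d (f a) = c a) ∧ Set.InjOn f (T.children u) := by
    intro u w
    by_cases huw : c u = d w
    · rw [hc u, hd w, node_inj] at huw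
      obtain ⟨f, hf⟩ := exists_matching huw S.root
      exact ⟨f, fun _ => hf⟩
    · exact ⟨fun _ => S.root, fun h => absurd h huw⟩
  choose σ hσ using hσ
  let E : ℕ → V → W := fun k =>
    k.rec (fun _ => S.root) fun _ f v => σ (T.parent v) (f (T.parent v)) v
  let e : V → W := fun v => E (T.depth v) v
  have e_root : e T.root = S.root := by
    change E (T.depth T.root) T.root = S.root
    rw [T.depth_root]; rfl
  have e_step : ∀ v, v ≠ T.root → e v = σ (T.parent v) (e (T.parent v)) v := by
    intro v hv
    change E (T.depth v) v = _
    rw [← T.depth_parent v hv]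
  have mem_ch : ∀ v, v ≠ T.root → v ∈ T.children (T.parent v) :=
    fun v hv => mem_children.2 ⟨hv, rfl⟩
  have e_code : ∀ k v, T.depth v = k → d (e v) = c v ∧ S.depth (e v) = k := by
    intro k
    induction k with
    | zero =>
      intro v hv
      have : v = T.root := by
        by_contra hne
        have := T.depth_parent v hne
        omega
      subst this
      exact ⟨by rw [e_root, h], by rw [e_root, S.depth_root]⟩
    | succ k ih =>
      intro v hv
      have hne : v ≠ T.root := by
        rintro rfl
        rw [T.depth_root] at hv
        omega
      have hp := ih (T.parent v) (by have := T.depth_parent v hne; omega)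
      obtain ⟨h1, h2⟩ := (hσ _ _ hp.1.symm).1 v (mem_ch v hne)
      rw [← e_step v hne] at h1 h2
      exact ⟨h2, by rw [depth_of_mem_children h1, hp.2]⟩
  have e_parent : ∀ v, v ≠ T.root → e v ∈ S.children (e (T.parent v)) := by
    intro v hv
    rw [e_step v hv]
    exact ((hσ _ _ (e_code _ _ rfl).1.symm).1 v (mem_ch v hv)).1
  have e_inj : ∀ k v w, T.depth v = k → e v = e w → v = w := by
    intro k
    induction k with
    | zero =>
      intro v w hv hvw
      have h1 := (e_code _ v rfl).2
      have h2 := (e_code _ w rfl).2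
      rw [hvw, h2, hv] at h1
      by_contra hne
      by_cases hv' : v = T.root
      · have := T.depth_parent w (fun hw => hne (hv'.trans hw.symm))
        omega
      · have := T.depth_parent v hv'
        omega
    | succ k ih =>
      intro v w hv hvw
      have h1 := (e_code _ v rfl).2
      have h2 := (e_code _ w rfl).2
      rw [hvw, h2, hv] at h1
      have hv' : v ≠ T.root := by
        rintro rfl
        rw [T.depth_root] at hv
        omega
      have hw' : w ≠ T.root := by
        rintro rfl
        rw [T.depth_root] at h1
        omega
      have hp : T.parent v = T.parent w := by
        refine ih _ _ (by have := T.depth_parent v hv'; omega) ?_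
        rw [← (mem_children.1 (e_parent v hv')).2, ← (mem_children.1 (e_parent w hw')).2, hvw]
      rw [e_step v hv', e_step w hw', ← hp] at hvw
      exact (hσ _ _ (e_code _ _ rfl).1.symm).2 (mem_ch v hv') (by
        rw [hp]; exact mem_ch w hw') hvw
  exact ⟨e, fun v w => e_inj _ v w rfl, e_root, fun v hv => mem_children.1 (e_parent v hv)⟩

theorem card_le_of_isCode {T : ParentTree V} {S : ParentTree W} {c : V → MTree}
    {d : W → MTree} (hc : T.IsCode c) (hd : S.IsCode d) (h : c T.root = d S.root) :
    Fintype.card V ≤ Fintype.card W :=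
  let ⟨_, he, _⟩ := exists_injective_of_isCode hc hd h
  Fintype.card_le_of_injective _ he

theorem toGraph_isTree (T : ParentTree V) : T.toGraph.IsTree := by
  classical
  rw [SimpleGraph.isTree_iff_connected_and_card]
  refine ⟨T.toGraph_connected, le_antisymm ?_ T.toGraph_connected.card_vert_le_card_edgeSet_add_one⟩
  have hsub : T.toGraph.edgeSet ⊆
      ((Finset.univ.erase T.root).image fun v => s(v, T.parent v) : Finset (Sym2 V)) := by
    intro e
    induction e with
    | _ u v =>
      intro huv
      rw [SimpleGraph.mem_edgeSet] at huv
      rcases huv with ⟨h, rfl⟩ | ⟨h, rfl⟩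
      · simp only [Finset.coe_image, Set.mem_image]
        exact ⟨u, by simpa using h, rfl⟩
      · simp only [Finset.coe_image, Set.mem_image]
        exact ⟨v, by simpa using h, Sym2.eq_swap⟩
  have h1 := Set.ncard_le_ncard hsub (Finset.finite_toSet _)
  rw [Set.ncard_coe_finset] at h1
  have h2 := h1.trans Finset.card_image_le
  rw [Finset.card_erase_of_mem (Finset.mem_univ _), Finset.card_univ] at h2
  have h3 : 0 < Fintype.card V := Fintype.card_pos_iff.2 ⟨T.root⟩
  rw [Nat.card_coe_set_eq, Nat.card_eq_fintype_card]
  omega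

/-- The rooted graph of a tree on `Fin n`. -/
def toRooted {n : ℕ} (T : ParentTree (Fin n)) : RootedGraphTree n :=
  ⟨T.toGraph, T.toGraph_isTree, T.root⟩

theorem iso_of_isCode {n : ℕ} {T S : ParentTree (Fin n)} {c d : Fin n → MTree}
    (hc : T.IsCode c) (hd : S.IsCode d) (h : c T.root = d S.root) :
    RootedGraphTree.Iso T.toRooted S.toRooted := by
  obtain ⟨e, he, hr, hp⟩ := exists_injective_of_isCode hc hd h
  refine ⟨⟨Equiv.ofBijective e (Finite.injective_iff_bijective.1 he), ?_⟩, hr⟩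
  have key : ∀ u v, (e u ≠ S.root ∧ S.parent (e u) = e v) ↔ (u ≠ T.root ∧ T.parent u = v) := by
    intro u v
    by_cases hu : u = T.root
    · simp [hu, hr]
    · rw [(hp u hu).2, he.eq_iff]
      simp [hu, (hp u hu).1]
  intro u v
  exact or_congr (key u v) (key v u)

/-- Each rooted graph comes from the parent structure of its distances to the root: the graph of
the latter is connected, and a tree is a minimal connected graph. -/
theorem exists_toRooted_eq {n : ℕ} (t : RootedGraphTree n) :
    ∃ T : ParentTree (Fin n), T.toRooted = t := by
  have hconn := t.isTree.1
  have hex : ∀ v, ∃ w, v ≠ t.root → t.graph.Adj v w ∧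
      t.graph.dist w t.root + 1 = t.graph.dist v t.root := by
    intro v
    by_cases hv : v = t.root
    · exact ⟨v, fun h => absurd hv h⟩
    · obtain ⟨p, hp⟩ := hconn.exists_walk_length_eq_dist v t.root
      cases p with
      | nil => exact absurd rfl hv
      | cons hadj q =>
        rename_i w
        refine ⟨w, fun _ => ⟨hadj, ?_⟩⟩
        rw [SimpleGraph.Walk.length_cons] at hp
        have h1 := SimpleGraph.dist_le q
        have h2 := hconn.dist_triangle (u := v) (v := w) (w := t.root)
        rw [SimpleGraph.dist_eq_one_iff_adj.2 hadj] at h2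
        omega
  choose par hpar using hex
  let T : ParentTree (Fin n) :=
    ⟨t.root, par, fun v => t.graph.dist v t.root, SimpleGraph.dist_self,
      fun v hv => (hpar v hv).2⟩
  have hle : T.toGraph ≤ t.graph := by
    rintro u v (⟨h, rfl⟩ | ⟨h, rfl⟩)
    · exact (hpar _ h).1
    · exact (hpar _ h).1.symm
  have heq : T.toGraph = t.graph :=
    le_antisymm hle
      ((SimpleGraph.isTree_iff_minimal_connected.1 t.isTree).2 T.toGraph_connected hle)
  refine ⟨T, ?_⟩
  obtain ⟨g, hg, r⟩ := t
  simp only [toRooted, RootedGraphTree.mk.injEq]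
  exact ⟨heq, rfl⟩

end ParentTree

open Classical in
/-- The function that is `1` at the one-vertex tree and `0` elsewhere. -/
noncomputable def MTree.leafInd (x : MTree) : ℕ := if x = leaf then 1 else 0

theorem MTree.leafInd_leaf : leafInd leaf = 1 := if_pos rfl

theorem MTree.leafInd_of_ne {x : MTree} (h : x ≠ leaf) : leafInd x = 0 := if_neg h

namespace ParentTree

variable {V W : Type}

open Classical in
/-- The tree obtained from `S` by hanging `T` from its root. -/
noncomputable def graft (T : ParentTree V) (S : ParentTree W) : ParentTree (V ⊕ W) where
  root := Sum.inr S.root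
  parent := Sum.elim (fun v => if v = T.root then Sum.inr S.root else Sum.inl (T.parent v))
    fun w => Sum.inr (S.parent w)
  depth := Sum.elim (fun v => T.depth v + 1) S.depth
  depth_root := S.depth_root
  depth_parent := by
    rintro (v | w) h
    · by_cases hv : v = T.root
      · simp [hv, T.depth_root, S.depth_root]
      · simp [hv, T.depth_parent v hv]
    · exact S.depth_parent w fun hw => h (by rw [hw])

/-- The transport of a tree along a bijection of the vertices. -/
def map (T : ParentTree V) (e : V ≃ W) : ParentTree W where
  root := e T.root
  parent w := e (T.parent (e.symm w))
  depth w := T.depth (e.symm w)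
  depth_root := by rw [e.symm_apply_apply, T.depth_root]
  depth_parent w h := by
    rw [e.symm_apply_apply]
    exact T.depth_parent _ fun hw => h (by rw [← hw, e.apply_symm_apply])

variable [Fintype V] [Fintype W]

theorem IsCode.map {T : ParentTree V} {c : V → MTree} (hc : T.IsCode c) (e : V ≃ W) :
    (T.map e).IsCode (c ∘ e.symm) := by
  intro w
  have h : (T.map e).children w = (T.children (e.symm w)).map e.toEmbedding := by
    ext z
    rw [Finset.mem_map_equiv, mem_children, mem_children]
    simp [ParentTree.map, ← Equiv.eq_symm_apply]
  rw [h, Finset.map_val, Multiset.map_map, Function.comp_apply, hc]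
  congr 1
  exact Multiset.map_congr rfl fun v _ => by simp

open Classical in
theorem IsCode.graft {T : ParentTree V} {S : ParentTree W} {c : V → MTree} {d : W → MTree}
    (hc : T.IsCode c) (hd : S.IsCode d) :
    (T.graft S).IsCode (Sum.elim c
      (Function.update d S.root (node (c T.root ::ₘ (d S.root).children)))) := by
  rintro (v | w)
  · have h : (T.graft S).children (Sum.inl v) = (T.children v).disjSum ∅ := by
      ext (z | z)
      · rw [Finset.inl_mem_disjSum, mem_children, mem_children]
        by_cases hz : z = T.root <;> simp [ParentTree.graft, hz]
      · simp [mem_children, ParentTree.graft]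
    rw [h, Finset.val_disjSum]
    simp only [Sum.elim_inl, Multiset.disjSum, Finset.empty_val, Multiset.map_zero, add_zero,
      Multiset.map_map]
    exact hc v
  · have h : (T.graft S).children (Sum.inr w) =
        (if w = S.root then {T.root} else ∅ : Finset V).disjSum (S.children w) := by
      ext (z | z)
      · rw [Finset.inl_mem_disjSum, mem_children]
        by_cases hz : z = T.root <;> by_cases hw : w = S.root <;>
          simp [ParentTree.graft, hz, hw, eq_comm]
      · rw [Finset.inr_mem_disjSum, mem_children, mem_children]
        simp [ParentTree.graft]
    have hch : (S.children w).val.map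
        (Function.update d S.root (node (c T.root ::ₘ (d S.root).children))) =
        (S.children w).val.map d :=
      Multiset.map_congr rfl fun z hz =>
        Function.update_of_ne (mem_children.1 (Finset.mem_def.2 hz)).1 _ _
    rw [h, Finset.val_disjSum]
    simp only [Sum.elim_inr, Multiset.disjSum, Multiset.map_add, Multiset.map_map,
      Function.comp_def, Sum.elim_inl]
    rw [hch]
    by_cases hw : w = S.root
    · subst hw
      rw [Function.update_self, hd S.root]
      simp
    · rw [Function.update_of_ne hw, hd w]
      simp [hw]

/-- Each unordered tree is carried by some parent structure, built by hanging the subtrees one by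
one from the root. -/
theorem exists_realization (x : MTree) :
    ∃ (V : Type) (_ : Fintype V) (T : ParentTree V) (c : V → MTree), T.IsCode c ∧
      c T.root = x ∧ Fintype.card V = size x ∧ (∑ v, leafInd (c v)) = leaves x := by
  induction x using MTree.induction with
  | h m ih =>
    induction m using Multiset.induction_on with
    | empty =>
      refine ⟨Unit, inferInstance, ⟨(), id, fun _ => 0, rfl, fun v h => absurd rfl h⟩,
        fun _ => leaf, fun v => ?_, rfl, ?_, ?_⟩
      · have : (ParentTree.children ⟨(), id, fun _ => 0, rfl, fun v h => absurd rfl h⟩ v :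
            Finset Unit) = ∅ := by
          ext w; simp [mem_children]
        rw [this]; rfl
      · exact size_leaf.symm
      · rw [Fintype.sum_unique, leafInd_leaf]; exact leaves_leaf.symm
    | cons t m ihm =>
      obtain ⟨W, _, S, d, hd, hdr, hdc, hdl⟩ := ihm fun t ht => ih t (Multiset.mem_cons_of_mem ht)
      obtain ⟨V, _, T, c, hc, hcr, hcc, hcl⟩ := ih t (Multiset.mem_cons_self t m)
      classical
      refine ⟨V ⊕ W, inferInstance, T.graft S, _, hc.graft hd, ?_, ?_, ?_⟩
      · simp [ParentTree.graft, hdr, hcr]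
      · rw [Fintype.card_sum, hcc, hdc, size_node, size_node, fsize_cons, add_assoc]
      · have hne : node (t ::ₘ m) ≠ leaf := by simp [leaf]
        rw [Fintype.sum_sum_type]
        simp only [Sum.elim_inl, Sum.elim_inr]
        rw [hcl, hcr, hdr, children_node, leaves_node (by simp), fleaves_cons]
        congr 1
        rw [← Finset.add_sum_erase _ _ (Finset.mem_univ S.root)] at hdl ⊢
        rw [Function.update_self, leafInd_of_ne hne, zero_add]
        have h1 : ∑ w ∈ Finset.univ.erase S.root,
            leafInd (Function.update d S.root (node (t ::ₘ m)) w) =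
            ∑ w ∈ Finset.univ.erase S.root, leafInd (d w) :=
          Finset.sum_congr rfl fun w hw => by
            rw [Function.update_of_ne (Finset.ne_of_mem_erase hw)]
        rw [h1]
        rw [hdr] at hdl
        by_cases hm : m = 0
        · subst hm
          rw [show leafInd (node 0) = 1 from leafInd_leaf,
            show leaves (node 0) = 1 from leaves_leaf] at hdl
          rw [fleaves_zero]
          omega
        · rw [leafInd_of_ne (by simpa [leaf] using hm), leaves_node hm] at hdl
          omega

theorem exists_realization_fin {n : ℕ} {x : MTree} (hx : size x = n) :
    ∃ (T : ParentTree (Fin n)) (c : Fin n → MTree), T.IsCode c ∧ c T.root = x ∧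
      (∑ v, leafInd (c v)) = leaves x := by
  obtain ⟨V, _, T, c, hc, hr, hcard, hl⟩ := exists_realization x
  let e : V ≃ Fin n := Fintype.equivFinOfCardEq (hcard.trans hx)
  refine ⟨T.map e, c ∘ e.symm, hc.map e, by simp [ParentTree.map, hr], ?_⟩
  rw [← hl]
  exact Equiv.sum_comp e.symm fun v => leafInd (c v)

theorem size_of_isCode {n : ℕ} {T : ParentTree (Fin n)} {c : Fin n → MTree} (hc : T.IsCode c) :
    size (c T.root) = n := by
  obtain ⟨S, d, hd, hr, -⟩ := exists_realization_fin (x := c T.root) rfl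
  have h1 := card_le_of_isCode hc hd hr.symm
  have h2 := card_le_of_isCode hd hc hr
  simp only [Fintype.card_fin] at h1 h2
  omega

theorem isLeaf_toRooted_iff {n : ℕ} {T : ParentTree (Fin n)} {c : Fin n → MTree}
    (hc : T.IsCode c) (v : Fin n) : T.toRooted.IsLeaf v ↔ c v = leaf := by
  by_cases hv : v = T.root
  · subst hv
    rw [← size_eq_one, size_of_isCode hc]
    simp [RootedGraphTree.IsLeaf, toRooted]
  · have hnb : T.toRooted.graph.neighborSet v =
        (insert (T.parent v) (T.children v) : Finset _) := by
      ext w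
      rw [SimpleGraph.mem_neighborSet, Finset.mem_coe, Finset.mem_insert, mem_children]
      change (_ ∧ _) ∨ (_ ∧ _) ↔ _
      simp [hv, eq_comm]
    have hnot : T.parent v ∉ T.children v := fun h => by
      have h1 := depth_of_mem_children h
      have h2 := T.depth_parent v hv
      omega
    have hr : v ≠ T.toRooted.root := hv
    rw [RootedGraphTree.IsLeaf, hnb, Set.ncard_coe_finset, Finset.card_insert_of_notMem hnot,
      hc.eq_leaf_iff]
    simp [hr]

theorem numLeaves_toRooted {n : ℕ} {T : ParentTree (Fin n)} {c : Fin n → MTree}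
    (hc : T.IsCode c) : T.toRooted.numLeaves = ∑ v, leafInd (c v) := by
  classical
  simp only [leafInd]
  rw [RootedGraphTree.numLeaves, ← Finset.card_filter, ← Set.ncard_coe_finset]
  congr 1
  ext v
  simp [isLeaf_toRooted_iff hc]

/-- An isomorphism that preserves the roots respects parents, by induction on the depth. -/
theorem code_root_eq_of_iso {n : ℕ} {T S : ParentTree (Fin n)} {c d : Fin n → MTree}
    (hc : T.IsCode c) (hd : S.IsCode d) (h : RootedGraphTree.Iso T.toRooted S.toRooted) :
    c T.root = d S.root := by
  obtain ⟨e, he⟩ := h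
  have key : ∀ k v, T.depth v = k → S.depth (e v) = k ∧
      (v ≠ T.root → e v ≠ S.root ∧ S.parent (e v) = e (T.parent v)) := by
    intro k
    induction k with
    | zero =>
      intro v hv
      have hv' : v = T.root := by
        by_contra hne
        have := T.depth_parent v hne
        omega
      subst hv'
      exact ⟨by rw [show e T.root = S.root from he, S.depth_root], fun h => absurd rfl h⟩
    | succ k ih =>
      intro v hv
      have hne : v ≠ T.root := by
        rintro rfl
        rw [T.depth_root] at hv
        omega
      have hd := T.depth_parent v hne
      obtain ⟨h1, h2⟩ := ih (T.parent v) (by omega)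
      have hadj : S.toGraph.Adj (e v) (e (T.parent v)) := e.map_adj_iff.2 (Or.inl ⟨hne, rfl⟩)
      rcases hadj with h3 | h3
      · refine ⟨?_, fun _ => h3⟩
        rw [← S.depth_parent _ h3.1, h3.2, h1]
      · have hp : T.parent v ≠ T.root := fun h => h3.1 (by rw [h]; exact he)
        have h4 : T.parent (T.parent v) = v := e.injective ((h2 hp).2.symm.trans h3.2)
        have h5 := T.depth_parent _ hp
        rw [h4] at h5
        omega
  have hde : T.IsCode (d ∘ e) := by
    intro v
    have hch : S.children (e v) = (T.children v).map e.toEquiv.toEmbedding := by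
      ext z
      obtain ⟨w, rfl⟩ := e.surjective z
      rw [mem_children, show (e w) = e.toEquiv.toEmbedding w from rfl, Finset.mem_map',
        mem_children]
      change e w ≠ S.root ∧ S.parent (e w) = e v ↔ _
      by_cases hw : w = T.root
      · subst hw
        simp [show e T.root = S.root from he]
      · have := (key _ w rfl).2 hw
        simp [hw, this.1, this.2, e.injective.eq_iff]
    rw [Function.comp_apply, hd, hch, Finset.map_val, Multiset.map_map]
    rfl
  rw [hc.unique hde, Function.comp_apply, show e T.root = S.root from he]

end ParentTree

/-- Rooted unlabelled trees with `n` vertices correspond to unordered trees of size `n`. -/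
theorem exists_equiv_unlabelledTree (n : ℕ) :
    ∃ E : {x : MTree // size x = n} ≃ UnlabelledTree n, ∀ x, (E x).numLeaves = leaves x.1 := by
  choose T c hc hr hl using fun x : {x : MTree // size x = n} =>
    ParentTree.exists_realization_fin x.2
  let f : {x : MTree // size x = n} → UnlabelledTree n := fun x => Quotient.mk _ (T x).toRooted
  have hf : Function.Bijective f := by
    constructor
    · intro x y h
      have := ParentTree.code_root_eq_of_iso (hc x) (hc y) (Quotient.exact h)
      rw [hr, hr] at this
      exact Subtype.ext this
    · intro q
      induction q using Quotient.inductionOn with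
      | h t =>
        obtain ⟨S, rfl⟩ := ParentTree.exists_toRooted_eq t
        obtain ⟨d, hd⟩ := S.exists_isCode
        let x : {x : MTree // size x = n} := ⟨d S.root, ParentTree.size_of_isCode hd⟩
        exact ⟨x, Quotient.sound (ParentTree.iso_of_isCode (hc x) hd (hr x))⟩
  refine ⟨Equiv.ofBijective f hf, fun x => ?_⟩
  change (T x).toRooted.numLeaves = _
  rw [ParentTree.numLeaves_toRooted (hc x), hl]

/-! ### Counting trees by vertices and leaves -/

namespace MTree

theorem finite_size_eq (n : ℕ) : {x : MTree | size x = n}.Finite :=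
  let ⟨E, _⟩ := exists_equiv_unlabelledTree n
  Set.finite_coe_iff.1 (Finite.of_equiv _ E.symm)

/-- The unordered trees with `n` vertices. -/
noncomputable def trees (n : ℕ) : Finset MTree := (finite_size_eq n).toFinset

@[simp] theorem mem_trees {n : ℕ} {x : MTree} : x ∈ trees n ↔ size x = n := by simp [trees]

theorem natCard_unlabelledTree (n : ℕ) (p : ℕ → Prop) [DecidablePred p] :
    Nat.card {q : UnlabelledTree n // p q.numLeaves} =
      ((trees n).filter fun x => p (leaves x)).card := by
  obtain ⟨E, hE⟩ := exists_equiv_unlabelledTree n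
  rw [← Fintype.card_coe, ← Nat.card_eq_fintype_card]
  refine Nat.card_congr (((E.subtypeEquiv fun x => ?_ :
    {x : {x : MTree // size x = n} // p (leaves x.1)} ≃ _).symm.trans
      (Equiv.subtypeSubtypeEquivSubtypeInter (fun x => size x = n)
        fun x => p (leaves x))).trans (Equiv.subtypeEquivRight fun x => ?_))
  · rw [hE]
  · rw [Finset.mem_filter, mem_trees]

theorem treeCount_eq (n k : ℕ) : treeCount n k = ((trees n).filter fun x => leaves x = k).card :=
  natCard_unlabelledTree n (· = k)

theorem leafPoly_eq (n : ℕ) (z : ℝ) : leafPoly n z = ∑ x ∈ trees n, z ^ leaves x := by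
  rw [leafPoly, ← Finset.sum_fiberwise_of_maps_to (s := trees n) (t := Finset.range (n + 1))
    (g := leaves)]
  · refine Finset.sum_congr rfl fun k _ => ?_
    rw [treeCount_eq, ← nsmul_eq_mul, ← Finset.sum_const]
    exact Finset.sum_congr rfl fun x hx => by rw [(Finset.mem_filter.1 hx).2]
  · intro x hx
    have := leaves_le_size x
    rw [mem_trees] at hx
    rw [Finset.mem_range]
    omega

theorem trees_zero : trees 0 = ∅ := by
  ext x
  have := one_le_size x
  simp; omega

/-- A tree with at least two vertices is obtained by hanging one tree from the root of another,
which yields the recursive inequality for the Catalan numbers. -/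
theorem card_trees_le_catalan (n : ℕ) : (trees (n + 1)).card ≤ catalan n := by
  induction n using Nat.strong_induction_on with
  | _ n ih =>
    cases n with
    | zero =>
      rw [catalan_zero]
      refine Finset.card_le_one.2 fun x hx y hy => ?_
      rw [mem_trees, size_eq_one] at hx hy
      rw [hx, hy]
    | succ n =>
      have hsub : trees (n + 1 + 1) ⊆ (Finset.HasAntidiagonal.antidiagonal n).biUnion fun ij =>
          (trees (ij.1 + 1) ×ˢ trees (ij.2 + 1)).image fun ts => node (ts.1 ::ₘ children ts.2) := by
        intro x hx
        rw [mem_trees, ← node_children x, size_node] at hx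
        obtain ⟨t, ht⟩ : ∃ t, t ∈ children x := Multiset.exists_mem_of_ne_zero fun h0 => by
          rw [h0, fsize_zero] at hx; omega
        obtain ⟨m, hm⟩ := Multiset.exists_cons_of_mem ht
        rw [hm, fsize_cons] at hx
        have h1 := one_le_size t
        rw [Finset.mem_biUnion]
        refine ⟨(size t - 1, fsize m), ?_, ?_⟩
        · rw [Finset.HasAntidiagonal.mem_antidiagonal]; simp only; omega
        · refine Finset.mem_image.2 ⟨(t, node m), ?_, ?_⟩
          · rw [Finset.mem_product, mem_trees, mem_trees, size_node]
            exact ⟨by change size t = size t - 1 + 1; omega, rfl⟩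
          · rw [children_node, ← hm, node_children]
      rw [catalan_succ']
      refine (Finset.card_le_card hsub).trans (Finset.card_biUnion_le.trans ?_)
      refine Finset.sum_le_sum fun ij hij => ?_
      rw [Finset.HasAntidiagonal.mem_antidiagonal] at hij
      refine Finset.card_image_le.trans ?_
      rw [Finset.card_product]
      exact Nat.mul_le_mul (ih _ (by omega)) (ih _ (by omega))

theorem card_trees_le (n : ℕ) : (trees n).card ≤ 4 ^ n := by
  cases n with
  | zero => simp [trees_zero]
  | succ n =>
    refine (card_trees_le_catalan n).trans ?_
    rw [catalan_eq_centralBinom_div]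
    exact (Nat.div_le_self _ _).trans ((Nat.centralBinom_le_four_pow n).trans
      (Nat.pow_le_pow_right (by norm_num) n.le_succ))

/-- Joining two trees to a new root determines the unordered pair of the trees. -/
theorem treeCount_mul_le (n k n' k' : ℕ) :
    treeCount n k * treeCount n' k' ≤ 2 * treeCount (n + n' + 1) (k + k') := by
  rw [treeCount_eq, treeCount_eq, treeCount_eq, ← Finset.card_product]
  set s := (trees n).filter (fun x => leaves x = k) ×ˢ (trees n').filter fun x => leaves x = k'
  let f : MTree × MTree → MTree := fun p => node {p.1, p.2}
  have himg : s.image f ⊆ (trees (n + n' + 1)).filter fun x => leaves x = k + k' := by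
    intro x hx
    obtain ⟨⟨y, z⟩, hyz, rfl⟩ := Finset.mem_image.1 hx
    simp only [s, Finset.mem_product, Finset.mem_filter, mem_trees] at hyz
    simp only [f, Finset.mem_filter, mem_trees, size_node, Multiset.insert_eq_cons, fsize_cons,
      fsize_singleton]
    rw [leaves_node (by simp), fleaves_cons, fleaves_singleton]
    omega
  refine (Finset.card_le_mul_card_image s 2 fun x hx => ?_).trans
    (Nat.mul_le_mul_left 2 (Finset.card_le_card himg))
  obtain ⟨⟨y, z⟩, -, rfl⟩ := Finset.mem_image.1 hx
  have : (s.filter fun p => f p = f (y, z)) ⊆ {(y, z), (z, y)} := by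
    rintro ⟨a, b⟩ hab
    have h := (Finset.mem_filter.1 hab).2
    simp only [f, node_inj] at h
    have ha : a ∈ ({y, z} : Multiset MTree) := h ▸ by simp
    rw [Multiset.insert_eq_cons, Multiset.mem_cons, Multiset.mem_singleton] at ha
    rcases ha with rfl | rfl
    · simp only [Multiset.insert_eq_cons, Multiset.cons_inj_right, Multiset.singleton_inj] at h
      simp [h]
    · rw [Multiset.pair_comm y a] at h
      simp only [Multiset.insert_eq_cons, Multiset.cons_inj_right, Multiset.singleton_inj] at h
      simp [h]
  exact (Finset.card_le_card this).trans Finset.card_le_two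

/-- A tree with at least two vertices is extended in two disjoint ways: by a new root, which keeps
the number of leaves, and by a new leaf at the root. -/
theorem leafPoly_succ_ge {n : ℕ} (hn : 2 ≤ n) {z : ℝ} (hz : 0 ≤ z) :
    (1 + z) * leafPoly n z ≤ leafPoly (n + 1) z := by
  let f : MTree → MTree := fun x => node {x}
  let g : MTree → MTree := fun x => node (leaf ::ₘ children x)
  have hf : Function.Injective f := fun x y h => by simpa [f] using h
  have hg : Function.Injective g := fun x y h => by
    simp only [g, node_inj, Multiset.cons_inj_right] at h
    rw [← node_children x, h, node_children]
  have hch : ∀ x ∈ trees n, children x ≠ 0 := fun x hx h0 => by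
    rw [mem_trees, ← node_children x, h0, size_node, fsize_zero] at hx
    omega
  have hdisj : Disjoint ((trees n).image f) ((trees n).image g) := by
    rw [Finset.disjoint_left]
    intro x hx hx'
    obtain ⟨y, hy, rfl⟩ := Finset.mem_image.1 hx
    obtain ⟨w, hw, hwy⟩ := Finset.mem_image.1 hx'
    simp only [f, g, node_inj] at hwy
    have := congrArg Multiset.card hwy
    simp only [Multiset.card_cons, Multiset.card_singleton, Nat.add_eq_right,
      Multiset.card_eq_zero] at this
    exact hch w hw this
  have hsub : (trees n).image f ∪ (trees n).image g ⊆ trees (n + 1) := by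
    intro x hx
    rcases Finset.mem_union.1 hx with hx | hx
    · obtain ⟨y, hy, rfl⟩ := Finset.mem_image.1 hx
      rw [mem_trees] at hy ⊢
      simp [f, size_node, hy]
    · obtain ⟨y, hy, rfl⟩ := Finset.mem_image.1 hx
      rw [mem_trees, ← node_children y, size_node] at hy
      simp only [g, mem_trees, size_node, fsize_cons, size_leaf]
      omega
  rw [leafPoly_eq, leafPoly_eq]
  refine le_trans (le_of_eq ?_) (Finset.sum_le_sum_of_subset_of_nonneg hsub
    fun x _ _ => pow_nonneg hz _)
  rw [Finset.sum_union hdisj, Finset.sum_image hf.injOn, Finset.sum_image hg.injOn, add_mul,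
    one_mul, Finset.mul_sum]
  congr 1
  · exact Finset.sum_congr rfl fun x _ => by simp [f, leaves_node]
  · refine Finset.sum_congr rfl fun x hx => ?_
    simp only [g]
    rw [leaves_node (by simp), fleaves_cons, leaves_leaf, ← leaves_node (hch x hx),
      node_children, pow_add, pow_one]

theorem le_leafPoly (n : ℕ) {z : ℝ} (hz : 0 ≤ z) : z * (1 + z) ^ n ≤ leafPoly (n + 2) z := by
  induction n with
  | zero =>
    rw [pow_zero, mul_one, leafPoly_eq]
    have h : leaves (node {leaf}) = 1 := by simp [leaves_node]
    have := Finset.single_le_sum (f := fun x => z ^ leaves x) (s := trees (0 + 2))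
      (fun x _ => pow_nonneg hz _) (a := node {leaf}) (by simp [size_node])
    simpa [h] using this
  | succ n ih =>
    calc z * (1 + z) ^ (n + 1) = (1 + z) * (z * (1 + z) ^ n) := by ring
      _ ≤ (1 + z) * leafPoly (n + 2) z := by gcongr
      _ ≤ leafPoly (n + 1 + 2) z := leafPoly_succ_ge (by omega) hz

theorem leafPoly_nonneg (n : ℕ) {z : ℝ} (hz : 0 ≤ z) : 0 ≤ leafPoly n z := by
  rw [leafPoly_eq]
  exact Finset.sum_nonneg fun x _ => pow_nonneg hz _

/-- For `u ≤ 1` the inner vertices carry at most the weight of the leaves. -/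
theorem pow_mul_leafPoly_inv_le {n : ℕ} (hn : 2 ≤ n) {u : ℝ} (hu : 0 < u) (hu1 : u ≤ 1) :
    u ^ n * leafPoly n u⁻¹ ≤ leafPoly n u := by
  rw [leafPoly_eq, leafPoly_eq, Finset.mul_sum]
  calc ∑ x ∈ trees n, u ^ n * u⁻¹ ^ leaves x = ∑ x ∈ trees n, u ^ inner x := by
        refine Finset.sum_congr rfl fun x hx => ?_
        rw [mem_trees] at hx
        rw [← hx, ← leaves_add_inner x, pow_add, inv_pow]
        field_simp
    _ ≤ ∑ x ∈ trees n, u ^ leaves (reflect x) := by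
        refine Finset.sum_le_sum fun x hx => pow_le_pow_of_le_one hu.le hu1 (leaves_reflect_le ?_)
        rintro rfl
        rw [mem_trees, size_leaf] at hx
        omega
    _ = ∑ x ∈ (trees n).image reflect, u ^ leaves x :=
        (Finset.sum_image (f := fun x => u ^ leaves x) reflect_injective.injOn).symm
    _ ≤ ∑ x ∈ trees n, u ^ leaves x := by
        refine Finset.sum_le_sum_of_subset_of_nonneg (fun x hx => ?_) fun x _ _ => by positivity
        obtain ⟨y, hy, rfl⟩ := Finset.mem_image.1 hx
        rw [mem_trees] at hy ⊢
        rw [size_reflect, hy]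

theorem treeCount_three_one_pos : 0 < treeCount 3 1 := by
  rw [treeCount_eq]
  refine Finset.card_pos.2 ⟨node {node {leaf}}, ?_⟩
  simp [size_node, leaves_node]

theorem treeCount_five_four_pos : 0 < treeCount 5 4 := by
  rw [treeCount_eq]
  refine Finset.card_pos.2 ⟨node {leaf, leaf, leaf, leaf}, ?_⟩
  simp [size_node, leaves_node]

end MTree

/-! ### The radius of convergence -/

/-- The set of radii of absolute convergence, whose supremum is `treeRadius z`. -/
def convSet (z : ℝ) : Set ℝ := {x : ℝ | 0 ≤ x ∧ Summable (fun n : ℕ => leafPoly n z * x ^ n)}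

theorem mul_le_one_of_mem_convSet {x z : ℝ} (hz : 0 < z) (hx : x ∈ convSet z) :
    x * (1 + z) ≤ 1 := by
  obtain ⟨hx0, hs⟩ := hx
  by_contra! h
  have hx1 : 0 < x := by
    rcases hx0.eq_or_lt with h0 | h0
    · rw [← h0] at h; norm_num at h
    · exact h0
  have ht := (hs.tendsto_atTop_zero).comp (Filter.tendsto_add_atTop_nat 2)
  have hge : ∀ n : ℕ, z * x ^ 2 ≤ leafPoly (n + 2) z * x ^ (n + 2) := fun n => by
    calc z * x ^ 2 ≤ z * x ^ 2 * (x * (1 + z)) ^ n :=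
          le_mul_of_one_le_right (by positivity) (one_le_pow₀ h.le)
      _ = z * (1 + z) ^ n * x ^ (n + 2) := by rw [mul_pow]; ring
      _ ≤ _ := by gcongr; exact le_leafPoly n hz.le
  have := ge_of_tendsto' ht hge
  have : 0 < z * x ^ 2 := by positivity
  linarith

theorem bddAbove_convSet {z : ℝ} (hz : 0 < z) : BddAbove (convSet z) :=
  ⟨1 / (1 + z), fun _ hx => (le_div_iff₀ (by positivity)).2 (mul_le_one_of_mem_convSet hz hx)⟩

theorem zero_mem_convSet (z : ℝ) : (0 : ℝ) ∈ convSet z :=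
  ⟨le_rfl, summable_of_ne_finset_zero (s := {0}) fun n hn => by
    rw [zero_pow (by simpa using hn), mul_zero]⟩

theorem mul_sqrt_le_half {x z : ℝ} (hz : 0 < z) (hx : x ∈ convSet z) : x * √z ≤ 1 / 2 := by
  have h1 := mul_le_one_of_mem_convSet hz hx
  have h2 := Real.sq_sqrt hz.le
  have h3 := hx.1
  -- The inequality `2 √z ≤ 1 + z`.
  nlinarith [mul_nonneg h3 (sq_nonneg (√z - 1))]

theorem treeRadius_mul_sqrt_le {z B : ℝ} (hz : 0 < z) (h : ∀ x ∈ convSet z, x * √z ≤ B) :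
    treeRadius z * √z ≤ B := by
  have hs : 0 < √z := Real.sqrt_pos.2 hz
  rw [← le_div_iff₀ hs]
  exact csSup_le ⟨0, zero_mem_convSet z⟩ fun x hx => (le_div_iff₀ hs).2 (h x hx)

theorem bddAbove_radii :
    BddAbove ((fun z : ℝ => treeRadius z * √z) '' Set.Ioi 0) := by
  refine ⟨1 / 2, ?_⟩
  rintro _ ⟨z, hz, rfl⟩
  exact treeRadius_mul_sqrt_le hz fun x hx => mul_sqrt_le_half hz hx

theorem mul_sqrt_le_maxRadius {x z : ℝ} (hz : 0 < z) (hx : x ∈ convSet z) :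
    x * √z ≤ maxRadius :=
  (mul_le_mul_of_nonneg_right (le_csSup (bddAbove_convSet hz) hx) (Real.sqrt_nonneg z)).trans
    (le_csSup bddAbove_radii ⟨z, hz, rfl⟩)

theorem maxRadius_le_half : maxRadius ≤ 1 / 2 := by
  refine csSup_le ⟨_, 1, Set.mem_Ioi.2 one_pos, rfl⟩ ?_
  rintro _ ⟨z, hz, rfl⟩
  exact treeRadius_mul_sqrt_le hz fun x hx => mul_sqrt_le_half hz hx

theorem maxRadius_pos : 0 < maxRadius := by
  have h : (1 / 8 : ℝ) ∈ convSet 1 := by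
    refine ⟨by norm_num, Summable.of_nonneg_of_le
      (fun n => mul_nonneg (leafPoly_nonneg n zero_le_one) (by positivity)) (fun n => ?_)
      summable_geometric_two⟩
    have : leafPoly n 1 ≤ 4 ^ n := by
      rw [leafPoly_eq]
      simpa using (by exact_mod_cast card_trees_le n : ((trees n).card : ℝ) ≤ 4 ^ n)
    calc leafPoly n 1 * (1 / 8) ^ n ≤ 4 ^ n * (1 / 8) ^ n := by gcongr
      _ = (1 / 2) ^ n := by rw [← mul_pow]; norm_num
  have := mul_sqrt_le_maxRadius one_pos h
  rw [Real.sqrt_one] at this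
  linarith

/-- By the symmetry inequality, a weight `u ≤ 1` gives nothing better than the weight `u⁻¹`. -/
theorem mul_mem_convSet_inv {x u : ℝ} (hu : 0 < u) (hu1 : u ≤ 1) (hx : x ∈ convSet u) :
    u * x ∈ convSet u⁻¹ := by
  obtain ⟨hx0, hs⟩ := hx
  refine ⟨by positivity, (summable_nat_add_iff 2).1 ?_⟩
  refine Summable.of_nonneg_of_le
    (fun n => mul_nonneg (leafPoly_nonneg _ (by positivity)) (by positivity)) (fun n => ?_)
    ((summable_nat_add_iff 2).2 hs)
  calc leafPoly (n + 2) u⁻¹ * (u * x) ^ (n + 2)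
      = u ^ (n + 2) * leafPoly (n + 2) u⁻¹ * x ^ (n + 2) := by rw [mul_pow]; ring
    _ ≤ _ := by gcongr; exact pow_mul_leafPoly_inv_le (by omega) hu hu1

theorem exists_convSet_of_lt_maxRadius {y : ℝ} (hy0 : 0 < y) (hy : y < maxRadius) :
    ∃ z x, 1 ≤ z ∧ 0 < x ∧ x ∈ convSet z ∧ y < x * √z := by
  obtain ⟨_, ⟨z, hz, rfl⟩, hyz⟩ := exists_lt_of_lt_csSup (Set.nonempty_Ioi.image _) hy
  have hz' : 0 < z := hz
  have hs : 0 < √z := Real.sqrt_pos.2 hz'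
  have h1 : y / √z < treeRadius z := (div_lt_iff₀ hs).2 hyz
  obtain ⟨x, hx, hyx⟩ := exists_lt_of_lt_csSup ⟨0, zero_mem_convSet z⟩ h1
  have hx0 : 0 < x := (div_pos hy0 hs).trans hyx
  rw [div_lt_iff₀ hs] at hyx
  rcases le_total 1 z with h | h
  · exact ⟨z, x, h, hx0, hx, hyx⟩
  · refine ⟨z⁻¹, z * x, (one_le_inv₀ hz').2 h, by positivity, mul_mem_convSet_inv hz' h hx, ?_⟩
    have : z * x * √z⁻¹ = x * √z := by
      rw [Real.sqrt_inv]
      field_simp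
      rw [Real.sq_sqrt hz'.le]
    rwa [this]

/-! ### The upper bound -/

theorem natCard_leaves_ge (n b : ℕ) :
    Nat.card {q : UnlabelledTree n // (n : ℤ) - (b : ℤ) ≤ (q.numLeaves : ℤ)} =
      ((trees n).filter fun x => n ≤ leaves x + b).card := by
  rw [natCard_unlabelledTree n fun k => (n : ℤ) - (b : ℤ) ≤ (k : ℤ)]
  congr 1
  exact Finset.filter_congr fun x _ => by omega

theorem card_filter_mul_pow_le (n b : ℕ) {z : ℝ} (hz : 1 ≤ z) :
    (((trees n).filter fun x => n ≤ leaves x + b).card : ℝ) * z ^ n ≤ z ^ b * leafPoly n z := by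
  rw [leafPoly_eq, Finset.mul_sum, ← nsmul_eq_mul, ← Finset.sum_const]
  refine (Finset.sum_le_sum fun x hx => ?_).trans
    (Finset.sum_le_sum_of_subset_of_nonneg (Finset.filter_subset _ _) fun x _ _ => by positivity)
  rw [← pow_add, add_comm]
  exact pow_le_pow_right₀ hz (Finset.mem_filter.1 hx).2

/-- A weight `z ≥ 1` favours the trees with many leaves. -/
theorem exists_treesWithLeaves_le {x z : ℝ} (hz : 1 ≤ z) (hx : x ∈ convSet z) :
    ∃ M : ℝ, 0 < M ∧ ∀ N b : ℕ,
      (treesWithLeaves N b : ℝ) * (x * z) ^ N ≤ N * (z ^ b * M) := by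
  obtain ⟨M, hM⟩ := hx.2.tendsto_atTop_zero.bddAbove_range
  have hx0 := hx.1
  have hxz : x * z ≤ 1 := by
    have := mul_le_one_of_mem_convSet (by linarith) hx
    linarith
  refine ⟨max M 1, by positivity, fun N b => ?_⟩
  rw [treesWithLeaves, Nat.cast_sum, Finset.sum_mul]
  have hN : (N : ℝ) * (z ^ b * max M 1) = ∑ _n ∈ Finset.Icc 1 N, z ^ b * max M 1 := by simp
  rw [hN]
  refine Finset.sum_le_sum fun n hn => ?_
  rw [natCard_leaves_ge]
  calc (((trees n).filter fun x => n ≤ leaves x + b).card : ℝ) * (x * z) ^ N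
      ≤ ((trees n).filter fun x => n ≤ leaves x + b).card * (x * z) ^ n := by
        gcongr ?_ * ?_
        exact pow_le_pow_of_le_one (by positivity) hxz (Finset.mem_Icc.1 hn).2
    _ = ((trees n).filter fun x => n ≤ leaves x + b).card * z ^ n * x ^ n := by
        rw [mul_pow]; ring
    _ ≤ z ^ b * leafPoly n z * x ^ n :=
        mul_le_mul_of_nonneg_right (card_filter_mul_pow_le n b hz) (by positivity)
    _ = z ^ b * (leafPoly n z * x ^ n) := by ring
    _ ≤ z ^ b * max M 1 := by
        gcongr
        exact (hM ⟨n, rfl⟩).trans (le_max_left _ _)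

theorem one_le_treesWithLeaves {N : ℕ} (hN : 1 ≤ N) (b : ℕ) : 1 ≤ treesWithLeaves N b := by
  rw [treesWithLeaves]
  refine le_trans ?_
    (Finset.single_le_sum (fun _ _ => Nat.zero_le _) (Finset.mem_Icc.2 ⟨le_rfl, hN⟩))
  rw [natCard_leaves_ge]
  exact Finset.card_pos.2 ⟨leaf, by simp⟩

/-! ### The lower bound -/

/-- Half the number of trees with `N - 1` vertices and `k` leaves. The shift accounts for the new
root when two trees are joined, and the factor for the lost order of the two; this makes the
function supermultiplicative on `N ≥ 1`. -/
noncomputable def halfCount (N k : ℕ) : ℝ := treeCount (N - 1) k / 2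

theorem halfCount_nonneg (N k : ℕ) : 0 ≤ halfCount N k := by unfold halfCount; positivity

theorem halfCount_mul_le {N N' : ℕ} (hN : 1 ≤ N) (hN' : 1 ≤ N') (k k' : ℕ) :
    halfCount N k * halfCount N' k' ≤ halfCount (N + N') (k + k') := by
  have h := treeCount_mul_le (N - 1) k (N' - 1) k'
  rw [show N - 1 + (N' - 1) + 1 = N + N' - 1 by omega] at h
  have h' : (treeCount (N - 1) k : ℝ) * treeCount (N' - 1) k' ≤
      2 * treeCount (N + N' - 1) (k + k') := by exact_mod_cast h
  unfold halfCount
  linarith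

theorem halfCount_pow_le {N : ℕ} (hN : 1 ≤ N) (k : ℕ) {p : ℕ} (hp : 1 ≤ p) :
    halfCount N k ^ p ≤ halfCount (p * N) (p * k) := by
  induction p, hp using Nat.le_induction with
  | base => simp
  | succ p hp ih =>
    rw [pow_succ, add_mul, add_mul, one_mul, one_mul]
    exact (mul_le_mul_of_nonneg_right ih (halfCount_nonneg N k)).trans
      (halfCount_mul_le (Nat.mul_pos hp hN) hN _ _)

/-- Convex duality: if the exponential growth of the trees in which at least half of the vertices
are leaves were at most `c < log growthC1`, a line through the exponents would separate them from
the point `(1 / 2, c)`, and its slope would give a weight whose radius exceeds the maximum. -/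
theorem exists_exp_le_halfCount {c : ℝ} (hc : c < -Real.log maxRadius) :
    ∃ N k : ℕ, 1 ≤ N ∧ N ≤ 2 * k ∧ Real.exp (c * N) ≤ halfCount N k := by
  by_contra! H
  let A : Set ℝ := {a | ∃ N k : ℕ, 1 ≤ N ∧ 2 * k < N ∧ 0 < halfCount N k ∧
    a = (Real.log (halfCount N k) - c * N) / (N - 2 * k)}
  let B : Set ℝ := {a | ∃ N k : ℕ, 1 ≤ N ∧ N < 2 * k ∧ 0 < halfCount N k ∧
    a = -(Real.log (halfCount N k) - c * N) / (2 * k - N)}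
  have hA : A.Nonempty := by
    refine ⟨_, 4, 1, by norm_num, by norm_num, ?_, rfl⟩
    have := treeCount_three_one_pos
    unfold halfCount
    positivity
  have hB : B.Nonempty := by
    refine ⟨_, 6, 4, by norm_num, by norm_num, ?_, rfl⟩
    have := treeCount_five_four_pos
    unfold halfCount
    positivity
  have hAB : ∀ a ∈ A, ∀ b ∈ B, a ≤ b := by
    rintro _ ⟨N, k, hN, hk, hpos, rfl⟩ _ ⟨N', k', hN', hk', hpos', rfl⟩
    obtain ⟨p, hp⟩ : ∃ p, p = 2 * k' - N' := ⟨_, rfl⟩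
    obtain ⟨q, hq⟩ : ∃ q, q = N - 2 * k := ⟨_, rfl⟩
    have hpr : (2 * (k' : ℝ) - N') = p := by
      rw [hp, Nat.cast_sub hk'.le]; push_cast; ring
    have hqr : ((N : ℝ) - 2 * k) = q := by
      rw [hq, Nat.cast_sub hk.le]; push_cast; ring
    have hp1 : 1 ≤ p := by omega
    have hq1 : 1 ≤ q := by omega
    -- `p` copies of the first kind and `q` copies of the second one have exactly half as many
    -- leaves as vertices.
    have hbal : p * N + q * N' ≤ 2 * (p * k + q * k') := by
      have : (p : ℝ) * N + q * N' ≤ 2 * (p * k + q * k') := by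
        rw [← hpr, ← hqr]; apply le_of_eq; ring
      exact_mod_cast this
    have h1 := H (p * N + q * N') (p * k + q * k') (by nlinarith) hbal
    have h2 : halfCount N k ^ p * halfCount N' k' ^ q ≤
        halfCount (p * N + q * N') (p * k + q * k') :=
      (mul_le_mul (halfCount_pow_le hN k hp1) (halfCount_pow_le hN' k' hq1) (by positivity)
        (halfCount_nonneg _ _)).trans
        (halfCount_mul_le (Nat.mul_pos hp1 hN) (Nat.mul_pos hq1 hN') _ _)
    have h3 := Real.log_le_log (by positivity) (h2.trans h1.le)
    rw [Real.log_mul (by positivity) (by positivity), Real.log_pow, Real.log_pow, Real.log_exp]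
      at h3
    push_cast at h3
    have hp0 : (0 : ℝ) < p := by exact_mod_cast hp1
    have hq0 : (0 : ℝ) < q := by exact_mod_cast hq1
    rw [hpr, hqr, div_le_div_iff₀ hq0 hp0]
    linarith
  obtain ⟨σ, hσA, hσB⟩ := exists_between_of_forall_le hA hB hAB
  have key : ∀ N k : ℕ, 1 ≤ N → halfCount N k ≤ Real.exp (c * N + σ * (N - 2 * k)) := by
    intro N k hN
    rcases (halfCount_nonneg N k).eq_or_lt with h0 | hpos
    · rw [← h0]; positivity
    rw [← Real.log_le_iff_le_exp hpos]
    rcases lt_trichotomy (2 * k) N with h | h | h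
    · have h1 := hσA ⟨N, k, hN, h, hpos, rfl⟩
      have h2 : (0 : ℝ) < N - 2 * k := by
        have : ((2 * k : ℕ) : ℝ) < N := by exact_mod_cast h
        push_cast at this; linarith
      rw [div_le_iff₀ h2] at h1
      linarith
    · have h1 := H N k hN h.ge
      have h2 : (N : ℝ) - 2 * k = 0 := by rw [← h]; push_cast; ring
      rw [h2, mul_zero, add_zero, Real.log_le_iff_le_exp hpos]
      exact h1.le
    · have h1 := hσB ⟨N, k, hN, h, hpos, rfl⟩
      have h2 : (0 : ℝ) < 2 * k - N := by
        have : (N : ℝ) < ((2 * k : ℕ) : ℝ) := by exact_mod_cast h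
        push_cast at this; linarith
      rw [le_div_iff₀ h2] at h1
      linarith
  have hpoly : ∀ n : ℕ, leafPoly n (Real.exp (2 * σ)) ≤
      (n + 1 : ℕ) * (2 * Real.exp ((c + σ) * (n + 1))) := by
    intro n
    have hconst : ((n + 1 : ℕ) : ℝ) * (2 * Real.exp ((c + σ) * (n + 1))) =
        ∑ _k ∈ Finset.range (n + 1), 2 * Real.exp ((c + σ) * (n + 1)) := by simp
    rw [hconst, leafPoly]
    refine Finset.sum_le_sum fun k _ => ?_
    have h1 := key (n + 1) k (by omega)
    unfold halfCount at h1
    rw [Nat.add_sub_cancel, div_le_iff₀ two_pos] at h1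
    calc (treeCount n k : ℝ) * Real.exp (2 * σ) ^ k
        ≤ Real.exp (c * (n + 1 : ℕ) + σ * ((n + 1 : ℕ) - 2 * k)) * 2 * Real.exp (2 * σ) ^ k := by
          gcongr
      _ = 2 * Real.exp ((c + σ) * (n + 1)) := by
          rw [← Real.exp_nat_mul, mul_comm _ (2 : ℝ), mul_assoc, ← Real.exp_add]
          push_cast
          ring_nf
  have hmem : ∀ θ : ℝ, 0 < θ → θ < 1 → θ * Real.exp (-(c + σ)) ∈ convSet (Real.exp (2 * σ)) := by
    intro θ h0 h1
    refine ⟨by positivity, Summable.of_nonneg_of_le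
      (fun n => mul_nonneg (leafPoly_nonneg n (by positivity)) (by positivity)) (fun n => ?_)
      (f := fun n : ℕ => 2 * Real.exp (c + σ) * ((n : ℝ) ^ 1 * θ ^ n + θ ^ n)) ?_⟩
    · calc leafPoly n (Real.exp (2 * σ)) * (θ * Real.exp (-(c + σ))) ^ n
          ≤ (n + 1 : ℕ) * (2 * Real.exp ((c + σ) * (n + 1))) *
              (θ * Real.exp (-(c + σ))) ^ n := by gcongr; exact hpoly n
        _ = 2 * (Real.exp ((c + σ) * (n + 1)) * Real.exp (n * (-(c + σ)))) *
              ((n : ℝ) ^ 1 * θ ^ n + θ ^ n) := by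
            rw [mul_pow, ← Real.exp_nat_mul]; push_cast; ring
        _ = _ := by rw [← Real.exp_add]; ring_nf
    · exact ((summable_pow_mul_geometric_of_norm_lt_one 1
        (by rwa [Real.norm_of_nonneg h0.le])).add
        (summable_geometric_of_lt_one h0.le h1)).mul_left _
  have hle : ∀ θ : ℝ, 0 < θ → θ < 1 → θ * Real.exp (-c) ≤ maxRadius := by
    intro θ h0 h1
    have h2 := mul_sqrt_le_maxRadius (Real.exp_pos _) (hmem θ h0 h1)
    have h3 : √(Real.exp (2 * σ)) = Real.exp σ := by
      rw [show 2 * σ = σ + σ by ring, Real.exp_add, Real.sqrt_mul_self (Real.exp_pos σ).le]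
    rw [h3, mul_assoc, ← Real.exp_add] at h2
    rwa [show -(c + σ) + σ = -c by ring] at h2
  have hlt : maxRadius < Real.exp (-c) := by
    rw [← Real.log_lt_iff_lt_exp maxRadius_pos]
    linarith
  obtain ⟨y, hy1, hy2⟩ := exists_between hlt
  have hy0 : 0 < y := maxRadius_pos.trans hy1
  have := hle (y / Real.exp (-c)) (by positivity) ((div_lt_one (Real.exp_pos _)).2 hy2)
  rw [div_mul_cancel₀ _ (Real.exp_pos _).ne'] at this
  linarith

/-- The pair `(N, k)` is used `2 * b / N` times, to reach about `2 * b` vertices, of which at most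
`b` are not leaves. -/
theorem exp_le_treesWithLeaves {c : ℝ} (hc0 : 0 ≤ c) {N k : ℕ} (hN : 1 ≤ N) (hk : N ≤ 2 * k)
    (h : Real.exp (c * N) ≤ halfCount N k) {M b : ℕ} (hb : N ≤ 2 * b) (hM : 2 * b ≤ M) :
    Real.exp (c * (2 * b - N)) ≤ treesWithLeaves M b := by
  obtain ⟨p, hp⟩ : ∃ p, p = 2 * b / N := ⟨_, rfl⟩
  have hp1 : 1 ≤ p := hp ▸ (Nat.one_le_div_iff hN).2 hb
  have hpN : p * N ≤ 2 * b := hp ▸ Nat.div_mul_le_self _ _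
  have hpN' : 2 * b < p * N + N := by
    have := Nat.lt_div_mul_add (a := 2 * b) hN
    rwa [← hp] at this
  have h1 : Real.exp (c * (2 * b - N)) ≤ halfCount (p * N) (p * k) :=
    calc Real.exp (c * (2 * b - N)) ≤ Real.exp (p * (c * N)) := by
          have : ((2 * b : ℕ) : ℝ) ≤ ((p * N + N : ℕ) : ℝ) := by exact_mod_cast hpN'.le
          push_cast at this
          rw [Real.exp_le_exp]
          nlinarith
      _ = Real.exp (c * N) ^ p := Real.exp_nat_mul _ _
      _ ≤ halfCount N k ^ p := by gcongr
      _ ≤ _ := halfCount_pow_le hN k hp1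
  have hpos : 0 < halfCount (p * N) (p * k) := (Real.exp_pos _).trans_le h1
  have h2 : halfCount (p * N) (p * k) ≤ treeCount (p * N - 1) (p * k) := by
    unfold halfCount
    have : (0 : ℝ) ≤ treeCount (p * N - 1) (p * k) := by positivity
    linarith
  refine h1.trans (h2.trans ?_)
  have hn1 : 1 ≤ p * N - 1 := by
    by_contra hlt
    rw [halfCount, show p * N - 1 = 0 by omega, treeCount_eq, trees_zero] at hpos
    simp at hpos
  have hpk : p * N ≤ 2 * (p * k) := by nlinarith
  have h3 : treeCount (p * N - 1) (p * k) ≤ treesWithLeaves M b := by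
    rw [treesWithLeaves]
    refine le_trans ?_ (Finset.single_le_sum (fun _ _ => Nat.zero_le _)
      (Finset.mem_Icc.2 ⟨hn1, by omega⟩ : p * N - 1 ∈ Finset.Icc 1 M))
    rw [natCard_leaves_ge, treeCount_eq]
    refine Finset.card_le_card fun x hx => ?_
    rw [Finset.mem_filter] at hx ⊢
    refine ⟨hx.1, ?_⟩
    rw [hx.2]
    omega
  exact_mod_cast h3

/-! ### The parameters of the bound and the asymptotics -/

theorem one_le_maxVertices (d : ℕ) : 1 ≤ maxVertices d := by
  unfold maxVertices; split_ifs <;> omega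

/-- The values of the parameters in terms of `e = [(d - 1) / 2] - 1`. -/
theorem exists_params (d : ℕ) (hd : 3 ≤ d) : ∃ e : ℕ, arnoldBound d = (e + 1) * e ∧
    (d = 2 * e + 3 ∧ maxVertices d = (e + 1) * (2 * e + 1) + 1 ∨
      d = 2 * e + 4 ∧ maxVertices d = (2 * e + 3) * (e + 1) + 2) := by
  rcases Nat.even_or_odd d with h | h
  · obtain ⟨f, rfl⟩ := h
    obtain ⟨e, rfl⟩ : ∃ e, f = e + 2 := ⟨f - 2, by omega⟩
    refine ⟨e, ?_, Or.inr ⟨by ring, ?_⟩⟩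
    · rw [arnoldBound, show (e + 2 + (e + 2) - 1) / 2 = e + 1 by omega, Nat.add_sub_cancel]
    · rw [maxVertices, if_neg (Nat.not_odd_iff_even.2 ⟨e + 2, rfl⟩),
        show e + 2 + (e + 2) - 1 = 2 * e + 3 by omega,
        show e + 2 + (e + 2) - 2 = 2 * (e + 1) by omega, Nat.mul_left_comm,
        Nat.mul_div_cancel_left _ two_pos]
  · obtain ⟨f, rfl⟩ := h
    obtain ⟨e, rfl⟩ : ∃ e, f = e + 1 := ⟨f - 1, by omega⟩
    refine ⟨e, ?_, Or.inl ⟨by ring, ?_⟩⟩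
    · rw [arnoldBound, show (2 * (e + 1) + 1 - 1) / 2 = e + 1 by omega, Nat.add_sub_cancel]
    · rw [maxVertices, if_pos ⟨e + 1, rfl⟩, Nat.add_sub_cancel,
        show 2 * (e + 1) + 1 - 2 = 2 * e + 1 by omega, Nat.mul_assoc,
        Nat.mul_div_cancel_left _ two_pos]

theorem two_mul_arnoldBound_le {d : ℕ} (hd : 3 ≤ d) : 2 * arnoldBound d ≤ maxVertices d := by
  obtain ⟨e, h, ⟨-, h'⟩ | ⟨-, h'⟩⟩ := exists_params d hd <;> rw [h, h'] <;> nlinarith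

theorem two_mul_maxVertices_le {d : ℕ} (hd : 3 ≤ d) : 2 * maxVertices d ≤ d ^ 2 + 4 := by
  obtain ⟨e, -, ⟨h, h'⟩ | ⟨h, h'⟩⟩ := exists_params d hd <;> rw [h'] <;> nlinarith

theorem four_mul_arnoldBound_le {d : ℕ} (hd : 3 ≤ d) : 4 * arnoldBound d ≤ d ^ 2 := by
  obtain ⟨e, h, ⟨h', -⟩ | ⟨h', -⟩⟩ := exists_params d hd <;> rw [h] <;> nlinarith

theorem le_four_mul_arnoldBound {d : ℕ} (hd : 3 ≤ d) : d ^ 2 ≤ 4 * arnoldBound d + 6 * d := by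
  obtain ⟨e, h, ⟨h', -⟩ | ⟨h', -⟩⟩ := exists_params d hd <;> rw [h, h'] <;> nlinarith

theorem log_treesWithLeaves_le {c : ℝ} (hc : -Real.log maxRadius < c) :
    ∃ K : ℝ, ∀ d : ℕ, 3 ≤ d → ∀ b, b ≤ arnoldBound d + 1 →
      Real.log (treesWithLeaves (maxVertices d) b) ≤ c * (d ^ 2 / 2) + K * d := by
  obtain ⟨z, x, hz, hx0, hx, hlt⟩ := exists_convSet_of_lt_maxRadius (Real.exp_pos (-c))
    (by rw [← Real.lt_log_iff_exp_lt maxRadius_pos]; linarith)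
  obtain ⟨M, hM0, hM⟩ := exists_treesWithLeaves_le hz hx
  have hz0 : 0 < z := by linarith
  have hxz : x * z ≤ 1 := by
    have := mul_le_one_of_mem_convSet hz0 hx
    linarith
  have hlz : 0 ≤ Real.log z := Real.log_nonneg hz
  have hlxz : 0 ≤ -Real.log (x * z) := by
    have := Real.log_nonpos (by positivity) hxz
    linarith
  have hsum : -Real.log (x * z) + Real.log z / 2 ≤ c := by
    have h1 := (Real.lt_log_iff_exp_lt (by positivity)).2 hlt
    rw [Real.log_mul hx0.ne' (Real.sqrt_pos.2 hz0).ne', Real.log_sqrt hz0.le] at h1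
    rw [Real.log_mul hx0.ne' hz0.ne']
    linarith
  refine ⟨2 + |Real.log M| + 2 * -Real.log (x * z) + Real.log z, fun d hd b hb => ?_⟩
  set N := maxVertices d with hN
  have hN1 : 1 ≤ N := one_le_maxVertices d
  have hL : (1 : ℝ) ≤ treesWithLeaves N b := by exact_mod_cast one_le_treesWithLeaves hN1 b
  have hN0 : (1 : ℝ) ≤ N := by exact_mod_cast hN1
  have h1 := Real.log_le_log (by positivity) (hM N b)
  rw [Real.log_mul (by positivity) (by positivity), Real.log_mul (by positivity) (by positivity),
    Real.log_mul (by positivity) (by positivity), Real.log_pow, Real.log_pow] at h1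
  have hd' : (3 : ℝ) ≤ d := by exact_mod_cast hd
  have hNd : (2 : ℝ) * N ≤ d ^ 2 + 4 := by exact_mod_cast two_mul_maxVertices_le hd
  have hbd : (4 : ℝ) * b ≤ d ^ 2 + 4 := by
    have : 4 * b ≤ d ^ 2 + 4 := by have := four_mul_arnoldBound_le hd; omega
    exact_mod_cast this
  have hlogN : Real.log N ≤ 2 * d := by
    calc Real.log N ≤ Real.log ((d : ℝ) ^ 2) := Real.log_le_log (by positivity) (by nlinarith)
      _ = 2 * Real.log d := by rw [Real.log_pow]; norm_num
      _ ≤ 2 * d := by linarith [Real.log_le_self (by linarith : (0 : ℝ) ≤ d)]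
  have h2 : (N : ℝ) * -Real.log (x * z) ≤ (d ^ 2 / 2 + 2) * -Real.log (x * z) :=
    mul_le_mul_of_nonneg_right (by linarith) hlxz
  have h3 : (b : ℝ) * Real.log z ≤ (d ^ 2 / 4 + 1) * Real.log z :=
    mul_le_mul_of_nonneg_right (by linarith) hlz
  have h4 : (d ^ 2 / 2 : ℝ) * (-Real.log (x * z) + Real.log z / 2) ≤ d ^ 2 / 2 * c := by gcongr
  have h5 : Real.log M ≤ |Real.log M| * d := (le_abs_self _).trans
    (le_mul_of_one_le_right (abs_nonneg _) (by linarith))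
  have h6 : 2 * -Real.log (x * z) + Real.log z ≤ (2 * -Real.log (x * z) + Real.log z) * d :=
    le_mul_of_one_le_right (by linarith) (by linarith)
  linarith

theorem le_log_treesWithLeaves {c : ℝ} (hc0 : 0 ≤ c) (hc : c < -Real.log maxRadius) :
    ∃ (K : ℝ) (d₀ : ℕ), ∀ d : ℕ, d₀ ≤ d → ∀ b, arnoldBound d ≤ b →
      c * (d ^ 2 / 2) - K * d ≤ Real.log (treesWithLeaves (maxVertices d) b) := by
  obtain ⟨N, k, hN, hk, h⟩ := exists_exp_le_halfCount hc
  refine ⟨c * (3 + N), N + 7, fun d hd b hb => ?_⟩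
  have h4 := le_four_mul_arnoldBound (d := d) (by omega)
  have hNb : N ≤ 2 * arnoldBound d := by nlinarith
  have h1 := exp_le_treesWithLeaves hc0 hN hk h hNb (two_mul_arnoldBound_le (by omega))
  have hmono : treesWithLeaves (maxVertices d) (arnoldBound d) ≤
      treesWithLeaves (maxVertices d) b := by
    refine Finset.sum_le_sum fun n _ => ?_
    rw [natCard_leaves_ge, natCard_leaves_ge]
    refine Finset.card_le_card fun x hx => ?_
    rw [Finset.mem_filter] at hx ⊢
    exact ⟨hx.1, by omega⟩
  have h2 := h1.trans (Nat.cast_le.2 hmono)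
  have h3 := Real.log_le_log (Real.exp_pos _) h2
  rw [Real.log_exp] at h3
  refine le_trans ?_ h3
  have h4' : (d : ℝ) ^ 2 ≤ 4 * arnoldBound d + 6 * d := by exact_mod_cast h4
  have hd1 : (1 : ℝ) ≤ d := by exact_mod_cast (by omega : 1 ≤ d)
  have hNd : (N : ℝ) ≤ N * d := le_mul_of_one_le_right (by positivity) hd1
  calc c * ((d : ℝ) ^ 2 / 2) - c * (3 + N) * d = c * (d ^ 2 / 2 - 3 * d - N * d) := by ring
    _ ≤ c * (2 * arnoldBound d - N) := by gcongr; linarith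

theorem expEquiv_treesWithLeaves {b : ℕ → ℕ} (hb : ∀ d, arnoldBound d ≤ b d)
    (hb' : ∀ d, b d ≤ arnoldBound d + 1) :
    ExpEquiv (fun d : ℕ => (treesWithLeaves (maxVertices d) (b d) : ℝ))
      (fun d : ℕ => growthC1 ^ ((d : ℝ) ^ 2 / 2)) := by
  set Λ : ℝ := -Real.log maxRadius with hΛ
  have hΛ0 : 0 < Λ := by
    have := Real.log_neg maxRadius_pos (by linarith [maxRadius_le_half])
    linarith
  have hg : ∀ d : ℕ, Real.log (growthC1 ^ ((d : ℝ) ^ 2 / 2)) = Λ * (d ^ 2 / 2) := fun d => by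
    have : 0 < growthC1 := one_div_pos.2 maxRadius_pos
    rw [Real.log_rpow this, growthC1, one_div, Real.log_inv, mul_comm]
  unfold ExpEquiv
  simp only [hg]
  rw [Asymptotics.IsEquivalent, Asymptotics.isLittleO_iff]
  intro ε hε
  -- Half of the error `ε Λ d ^ 2 / 2` is spent on the exponent, the other half on the linear term.
  obtain ⟨δ, hδ0, hδ1, hδ⟩ : ∃ δ : ℝ, 0 < δ ∧ δ < Λ ∧ δ ≤ ε * Λ / 2 :=
    ⟨min (Λ / 2) (ε * Λ / 2), by positivity, (min_le_left _ _).trans_lt (by linarith),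
      min_le_right _ _⟩
  obtain ⟨K, hK⟩ := log_treesWithLeaves_le (c := Λ + δ) (by linarith)
  obtain ⟨K', d₀, hK'⟩ := le_log_treesWithLeaves (c := Λ - δ) (by linarith) (by linarith)
  have hlin : ∀ C : ℝ, ∀ᶠ d : ℕ in Filter.atTop, C * d ≤ ε * Λ / 2 * (d ^ 2 / 2) := by
    intro C
    filter_upwards [Filter.eventually_ge_atTop ⌈C / (ε * Λ / 4)⌉₊] with d hd
    have h1 : C / (ε * Λ / 4) ≤ d := (Nat.le_ceil _).trans (by exact_mod_cast hd)
    rw [div_le_iff₀ (by positivity)] at h1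
    calc C * d ≤ d * (ε * Λ / 4) * d := by gcongr
      _ = _ := by ring
  filter_upwards [hlin K, hlin K', Filter.eventually_ge_atTop 3, Filter.eventually_ge_atTop d₀]
    with d h1 h2 h3 h4
  have h5 := hK d h3 (b d) (hb' d)
  have h6 := hK' d h4 (b d) (hb d)
  have h7 : δ * ((d : ℝ) ^ 2 / 2) ≤ ε * Λ / 2 * (d ^ 2 / 2) := by gcongr
  rw [Pi.sub_apply, Real.norm_eq_abs, Real.norm_of_nonneg (by positivity), abs_le]
  constructor <;> linarith

theorem theorem9 :
    ExpEquiv (fun d : ℕ => (treesWithLeaves (maxVertices d) (arnoldBound d) : ℝ))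
        (fun d : ℕ => growthC1 ^ ((d : ℝ) ^ 2 / 2)) ∧
      ExpEquiv (fun d : ℕ => (treesWithLeaves (maxVertices d) (arnoldBound d + 1) : ℝ))
        (fun d : ℕ => growthC1 ^ ((d : ℝ) ^ 2 / 2)) :=
  ⟨expEquiv_treesWithLeaves (fun _ => le_rfl) fun _ => Nat.le_succ _,
    expEquiv_treesWithLeaves (fun _ => Nat.le_succ _) fun _ => le_rfl⟩
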